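/- Let $k$ be a field and let $Q$ be a quiver of type $\mathbb{A}_n$ with vertex set $Q_0=\{1,\dots,n\}$: for each $1\le i<n$ there is exactly one arrow between $i$ and $i+1$, in an arbitrary direction, and there are no other arrows. Representations of $Q$ over $k$ are finite dimensional, and $\underline{\dim}\,V\in\mathbb{Z}^n$ is the dimension vector of $V$. A tilting module is a representation $T$ with $\mathrm{Ext}^1(T,T)=0$ that is a direct sum of as many pairwise non-isomorphic indecomposables as the quiver has vertices. A support tilting module is a representation that is tilting when restricted to the full subquiver on its support. A $2$-support tilting module is a module $T$ with a decomposition $T=T^+\oplus T^-$ such that $T^+$ and $T^-$ are support tilting and $Q_0$ is the disjoint union of their supports. Let $\mathcal{T}^+(Q)$, $\mathcal{T}^{\mathrm{clus}}(Q)$ and $\mathcal{T}(Q)$ be the sets of isomorphism classes of tilting, support tilting and $2$-support tilting modules; isomorphisms of $2$-support tilting modules respect the decomposition. For a tilting module $T$, let $\sigma_T\subset\mathbb{R}^n$ be the convex hull of $0$ and the dimension vectors of the indecomposable direct summands of $T$. For a support tilting module $T$, let $\sigma_T$ be the convex hull of $0$, these dimension vectors, and the vectors $-e_j$ for all vertices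 $j$ outside the support of $T$. For a $2$-support tilting module, let $\sigma_T$ be the convex hull of $0$, the dimension vectors of the indecomposable direct summands of $T^+$, and the negatives of the dimension vectors of the indecomposable direct summands of $T^-$. Let $P^+(Q)$, $P^{\mathrm{clus}}(Q)$ and $P(Q)$ be the unions of the sets $\sigma_T$ over all tilting, all support tilting and all $2$-support tilting modules, respectively. Let $\mathrm{vol}$ be the integral volume on $\mathbb{R}^n$, that is, $n!$ times Lebesgue measure. Then the sets $\mathcal{T}^+(Q)$, $\mathcal{T}^{\mathrm{clus}}(Q)$ and $\mathcal{T}(Q)$ are finite, and $$\mathrm{vol}\,P^+(Q)=\sharp\mathcal{T}^+(Q),\qquad \mathrm{vol}\,P^{\mathrm{clus}}(Q)=\sharp\mathcal{T}^{\mathrm{clus}}(Q),\qquad \mathrm{vol}\,P(Q)=\sharp\mathcal{T}(Q).$$ Moreover, in each of the three cases, every $\sigma_T$ is a unimodular simplex (its vertices are $0$ and the members of a $\mathbb{Z}$-basis of $\mathbb{Z}^n$) and $\mathrm{vol}\,\sigma_T=1$; and if $T$ and $T'$ are non-isomorphic, then $\sigma_T\cap\sigma_{T'}$ has measure zero. 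-/

import Mathlib

open MeasureTheory
open scoped Nat ENNReal

universe u v w

/-- A finite-dimensional representation over the field `k` of a quiver with vertex set `Q`. -/
structure QuiverRep (k : Type u) [Field k] (Q : Type v) [Quiver.{w} Q] where
  space : Q → Type u
  [addCommGroup : ∀ i, AddCommGroup (space i)]
  [module : ∀ i, Module k (space i)]
  [finiteDimensional : ∀ i, FiniteDimensional k (space i)]
  map : ∀ {i j : Q}, (i ⟶ j) → (space i →ₗ[k] space j)

namespace QuiverRep

attribute [instance] QuiverRep.addCommGroup QuiverRep.module QuiverRep.finiteDimensional

section General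

variable {k : Type u} [Field k] {Q : Type v} [Quiver.{w} Q]

/-- An isomorphism of representations. -/
structure Iso (V W : QuiverRep k Q) where
  equiv : ∀ i, V.space i ≃ₗ[k] W.space i
  comm : ∀ {i j : Q} (a : i ⟶ j) (x : V.space i),
    equiv j (V.map a x) = W.map a (equiv i x)

/-- Two representations are isomorphic. -/
def IsIsomorphic (V W : QuiverRep k Q) : Prop := Nonempty (Iso V W)

theorem IsIsomorphic.refl (V : QuiverRep k Q) : IsIsomorphic V V :=
  ⟨⟨fun i => LinearEquiv.refl k (V.space i), fun _ _ => rfl⟩⟩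

theorem IsIsomorphic.symm {V W : QuiverRep k Q} (h : IsIsomorphic V W) :
    IsIsomorphic W V := by
  obtain ⟨e⟩ := h
  refine ⟨⟨fun i => (e.equiv i).symm, fun {i j} a x => ?_⟩⟩
  rw [LinearEquiv.symm_apply_eq, e.comm, LinearEquiv.apply_symm_apply]

theorem IsIsomorphic.trans {V W X : QuiverRep k Q} (h : IsIsomorphic V W)
    (h₂ : IsIsomorphic W X) : IsIsomorphic V X := by
  obtain ⟨e⟩ := h
  obtain ⟨f⟩ := h₂
  refine ⟨⟨fun i => (e.equiv i).trans (f.equiv i), fun {i j} a x => ?_⟩⟩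
  simp only [LinearEquiv.trans_apply, e.comm, f.comm]

variable (k Q) in
/-- Isomorphism as an equivalence relation on representations. -/
def isoSetoid : Setoid (QuiverRep k Q) where
  r := IsIsomorphic
  iseqv := ⟨IsIsomorphic.refl, IsIsomorphic.symm, IsIsomorphic.trans⟩

variable (k Q) in
/-- Isomorphism classes of representations. -/
def IsoClass : Type (max (u + 1) v w) := Quotient (isoSetoid k Q)

/-- The isomorphism class of a representation. -/
def isoClass (V : QuiverRep k Q) : IsoClass k Q := Quotient.mk (isoSetoid k Q) V

/-- The direct sum of two representations. -/
def prod (V W : QuiverRep k Q) : QuiverRep k Q where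
  space i := V.space i × W.space i
  map a := LinearMap.prodMap (V.map a) (W.map a)

/-- The direct sum of a finite family of representations. -/
def directSum {ι : Type} [Finite ι] (M : ι → QuiverRep k Q) : QuiverRep k Q where
  space i := ∀ x, (M x).space i
  map a := LinearMap.pi fun x => (M x).map a ∘ₗ LinearMap.proj x

/-- The zero representation, up to isomorphism. -/
def IsZero (V : QuiverRep k Q) : Prop := ∀ i, Subsingleton (V.space i)

/-- A nonzero representation without a nontrivial decomposition into a direct sum of two. -/
def IsIndecomposable (V : QuiverRep k Q) : Prop :=
  ¬ V.IsZero ∧ ∀ A B : QuiverRep k Q, IsIsomorphic V (A.prod B) → A.IsZero ∨ B.IsZero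

/-- `M` is (isomorphic to) a direct summand of `V`. -/
def IsSummand (M V : QuiverRep k Q) : Prop := ∃ N, IsIsomorphic V (M.prod N)

/-- The map `Hom(P⁰, W) → Hom(P¹, W)` induced by the standard projective resolution
`0 → P¹ → P⁰ → V → 0`, where `P⁰ = ⨁ᵢ P(i) ⊗ V(i)` (sum over the vertices) and
`P¹ = ⨁ₐ P(t a) ⊗ V(s a)` (sum over the arrows), after the identification
`Hom(P(i) ⊗ X, W) = Hom(X, W(i))`. Its kernel is `Hom(V, W)`. -/
def extMap (V W : QuiverRep k Q) :
    (∀ i : Q, V.space i →ₗ[k] W.space i) →ₗ[k]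
      (∀ (i j : Q), (i ⟶ j) → (V.space i →ₗ[k] W.space j)) where
  toFun f := fun i j a => f j ∘ₗ V.map a - W.map a ∘ₗ f i
  map_add' f g := by
    funext i j a
    ext x
    simp only [LinearMap.sub_apply, LinearMap.comp_apply, Pi.add_apply, LinearMap.add_apply,
      map_add]
    abel
  map_smul' c f := by
    funext i j a
    ext x
    simp [smul_sub]

/-- `Ext¹(V, W)`: the cokernel of `Hom(P⁰, W) → Hom(P¹, W)`. -/
abbrev Ext1 (V W : QuiverRep k Q) : Type _ :=
  (∀ (i j : Q), (i ⟶ j) → (V.space i →ₗ[k] W.space j)) ⧸ LinearMap.range (extMap V W)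

/-- `Ext¹(V, V) = 0`. -/
def IsRigid (V : QuiverRep k Q) : Prop := Subsingleton (Ext1 V V)

/-- A tilting module: rigid, and a direct sum of `n` pairwise non-isomorphic indecomposable
representations, where `n` is the number of vertices. -/
def IsTilting (T : QuiverRep k Q) : Prop :=
  T.IsRigid ∧ ∃ M : Fin (Nat.card Q) → QuiverRep k Q,
    (∀ x, (M x).IsIndecomposable) ∧
    (∀ x y, x ≠ y → ¬ IsIsomorphic (M x) (M y)) ∧
    IsIsomorphic T (directSum M)

/-- The set of vertices at which the dimension vector is nonzero. -/
def support (V : QuiverRep k Q) : Set Q := {i | Module.finrank k (V.space i) ≠ 0}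

/-- The full subquiver on a set of vertices. -/
instance fullSubquiver (I : Set Q) : Quiver.{w} I where
  Hom i j := (i : Q) ⟶ (j : Q)

/-- The restriction of a representation to the full subquiver on `I`. -/
def restrict (V : QuiverRep k Q) (I : Set Q) : QuiverRep k I where
  space i := V.space i
  map {i j} a := V.map (i := (i : Q)) (j := (j : Q)) a

/-- A support tilting module: tilting when restricted to its support. -/
def IsSupportTilting (T : QuiverRep k Q) : Prop := (T.restrict T.support).IsTilting

/-- A 2-support tilting module `T = T⁺ ⊕ T⁻`, given by the pair `(T⁺, T⁻)`: both are support
tilting, and the vertex set is the disjoint union of their supports. -/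
def IsTwoSupportTilting (T : QuiverRep k Q × QuiverRep k Q) : Prop :=
  T.1.IsSupportTilting ∧ T.2.IsSupportTilting ∧ IsCompl T.1.support T.2.support

variable (k Q) in
/-- The set of isomorphism classes of tilting modules. -/
def tiltingClasses : Set (IsoClass k Q) :=
  {c | ∃ T : QuiverRep k Q, T.IsTilting ∧ T.isoClass = c}

variable (k Q) in
/-- The set of isomorphism classes of support tilting modules. -/
def supportTiltingClasses : Set (IsoClass k Q) :=
  {c | ∃ T : QuiverRep k Q, T.IsSupportTilting ∧ T.isoClass = c}

variable (k Q) in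
/-- The set of isomorphism classes of 2-support tilting modules (an isomorphism respects the
decomposition `T = T⁺ ⊕ T⁻`). -/
def twoSupportTiltingClasses : Set (IsoClass k Q × IsoClass k Q) :=
  {c | ∃ T : QuiverRep k Q × QuiverRep k Q,
    IsTwoSupportTilting T ∧ (T.1.isoClass, T.2.isoClass) = c}

/-- The dimension vector, as a vector in `ℝ^Q`. -/
noncomputable def dimVec (V : QuiverRep k Q) : Q → ℝ :=
  fun i => (Module.finrank k (V.space i) : ℝ)

/-- The dimension vectors of the indecomposable direct summands of `T`. -/
def summandDims (T : QuiverRep k Q) : Set (Q → ℝ) :=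
  {d | ∃ M : QuiverRep k Q, M.IsIndecomposable ∧ M.IsSummand T ∧ d = M.dimVec}

/-- The simplex of a tilting module: the convex hull of `0` and the dimension vectors of the
indecomposable direct summands. -/
def simplexTilt (T : QuiverRep k Q) : Set (Q → ℝ) :=
  convexHull ℝ ({0} ∪ T.summandDims)

/-- The simplex of a support tilting module: add to the generators the negatives of the
standard basis vectors at the vertices outside the support. -/
def simplexSupp [DecidableEq Q] (T : QuiverRep k Q) : Set (Q → ℝ) :=
  convexHull ℝ ({0} ∪ T.summandDims ∪ {d | ∃ j, j ∉ T.support ∧ d = -Pi.single j (1 : ℝ)})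

/-- The simplex of a 2-support tilting module `T = T⁺ ⊕ T⁻`. -/
def simplexTwo (T : QuiverRep k Q × QuiverRep k Q) : Set (Q → ℝ) :=
  convexHull ℝ ({0} ∪ T.1.summandDims ∪ {d | -d ∈ T.2.summandDims})

variable (k Q) in
/-- `P⁺(Q)`, the union of the simplices of all tilting modules. -/
def polyTilt : Set (Q → ℝ) :=
  {x | ∃ T : QuiverRep k Q, T.IsTilting ∧ x ∈ T.simplexTilt}

variable (k Q) in
/-- `P^clus(Q)`, the union of the simplices of all support tilting modules. -/
def polySupp [DecidableEq Q] : Set (Q → ℝ) :=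
  {x | ∃ T : QuiverRep k Q, T.IsSupportTilting ∧ x ∈ T.simplexSupp}

variable (k Q) in
/-- `P(Q)`, the union of the simplices of all 2-support tilting modules. -/
def polyTwo : Set (Q → ℝ) :=
  {x | ∃ T : QuiverRep k Q × QuiverRep k Q, IsTwoSupportTilting T ∧ x ∈ simplexTwo T}

end General

end QuiverRep

/-- The integral volume on `ℝ^Q` with `n = |Q|`: `n!` times Lebesgue measure. -/
noncomputable def integralVolume {Q : Type v} [Fintype Q] (S : Set (Q → ℝ)) : ℝ≥0∞ :=
  ((Fintype.card Q)! : ℝ≥0∞) * volume S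

/-- A simplex with vertices `0` and the members of a `ℤ`-basis of `ℤ^Q`. -/
def IsUnimodularSimplex {Q : Type v} (S : Set (Q → ℝ)) : Prop :=
  ∃ b : Module.Basis Q ℤ (Q → ℤ),
    S = convexHull ℝ ({0} ∪ Set.range fun x => fun i => ((b x i : ℤ) : ℝ))

/-- The vertex set of the quiver of type `A_n` with orientation `o`. The edge `e` joins the
vertices `e` and `e + 1`; it points to `e + 1` if `o e = true` and to `e` otherwise. -/
def TypeA (n : ℕ) (_o : Fin (n - 1) → Bool) : Type := Fin n

namespace TypeA

variable {n : ℕ} {o : Fin (n - 1) → Bool}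

instance : Fintype (TypeA n o) := inferInstanceAs (Fintype (Fin n))

instance : DecidableEq (TypeA n o) := inferInstanceAs (DecidableEq (Fin n))

/-- The position `0, …, n - 1` of a vertex. -/
def pos (i : TypeA n o) : ℕ := Fin.val (n := n) i

instance : Quiver (TypeA n o) where
  Hom i j := {e : Fin (n - 1) //
    (o e = true ∧ i.pos = e ∧ j.pos = e + 1) ∨ (o e = false ∧ i.pos = e + 1 ∧ j.pos = e)}

end TypeA

/-! Over a quiver of type A every indecomposable is an interval representation, so a tilting module
is coded by a set of `n` intervals with pairwise vanishing `Ext¹`. A support tilting or 2-support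
tilting module is coded by a pair of such sets with disjoint supports and `n` intervals in all, the
second set entering with a minus sign (one-point intervals in the support tilting case). The code
determines the isomorphism class, which gives finiteness.

The heart is the uniqueness of nonnegative combinations: if two nonnegative combinations of interval
vectors, each supported on a set of pairwise `Ext`-orthogonal intervals, have the same value, they
are equal (`IsCompatibleWeight.unique`). Comparing the two from left to right, the first difference
makes one of them contain two adjacent intervals, or else one contains a nested pair `[a,d]`,
`[c,m]` and the other a crossing pair `[a,m]`, `[c,d']`. Adjacent intervals extend each other. For
every direction of the two edges bounding the common part `[c,m]`, one of the nested and crossing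
pairs has a nonzero `Ext¹` (`not_extVanishes_nested_crossing`). Since positive and negative parts
live at different vertices, uniqueness carries over to signed combinations.

Everything else follows from uniqueness. The `n` generators of one simplex are linearly independent,
and they generate the lattice because interval vectors are edge vectors of a graph
(`IsFanPair.span_int_eq_top`); hence each simplex has integral volume 1. A point in two different
simplices is a combination of their common generators, of which there are fewer than `n`, so the
intersection is null. Adding up volumes counts the classes. Uniqueness also replaces the
Krull-Schmidt theorem for rigid modules: the weights are then the multiplicities. -/

namespace QuiverRep

/-! ### Thin representations and elementary isomorphisms of direct sums. -/

section Thin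

variable {k : Type u} [Field k] {Q : Type v} [Quiver.{w} Q]

/-- The scalars supported on a proposition: `k` if `p` holds and `0` otherwise. -/
def scalarsOn (k : Type u) [Field k] (p : Prop) : Submodule k k where
  carrier := {c | ¬ p → c = 0}
  add_mem' ha hb h := by rw [ha h, hb h, add_zero]
  zero_mem' _ := rfl
  smul_mem' c x hx h := by rw [hx h, smul_zero]

theorem scalarsOn_eq_top {p : Prop} (h : p) : scalarsOn k p = ⊤ :=
  top_unique fun _ _ hp => absurd h hp

theorem scalarsOn_eq_bot {p : Prop} (h : ¬ p) : scalarsOn k p = ⊥ :=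
  bot_unique fun _ hc => hc h

open Classical in
/-- The projection between spaces of scalars supported on propositions. -/
noncomputable def scalarsOnMap (k : Type u) [Field k] (p q : Prop) :
    scalarsOn k p →ₗ[k] scalarsOn k q where
  toFun c := ⟨if q then c else 0, fun h => if_neg h⟩
  map_add' a b := by ext; by_cases h : q <;> simp [h]
  map_smul' a b := by ext; by_cases h : q <;> simp [h]

/-- The thin representation with a one-dimensional space at each vertex of `I`, zero elsewhere,
and identity maps inside `I`. -/
noncomputable def thin (k : Type u) [Field k] {Q : Type v} [Quiver.{w} Q] (I : Set Q) :
    QuiverRep k Q where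
  space i := scalarsOn k (i ∈ I)
  map {i j} _ := scalarsOnMap k (i ∈ I) (j ∈ I)

/-- The vector `1` at a vertex of `I` (and `0` elsewhere). -/
noncomputable def thinOne (k : Type u) [Field k] (I : Set Q) (i : Q) : (thin k I).space i :=
  scalarsOnMap k True (i ∈ I) ⟨1, fun h => absurd trivial h⟩

open Classical in
theorem thinOne_val (I : Set Q) (i : Q) :
    Subtype.val (p := (· ∈ scalarsOn k (i ∈ I))) (thinOne k I i) = if i ∈ I then 1 else 0 := rfl

open Classical in
theorem thin_finrank (I : Set Q) (i : Q) :
    Module.finrank k ((thin k I).space i) = if i ∈ I then 1 else 0 := by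
  change Module.finrank k (scalarsOn k (i ∈ I)) = _
  split_ifs with h
  · rw [scalarsOn_eq_top h, finrank_top, Module.finrank_self]
  · rw [scalarsOn_eq_bot h, finrank_bot]

theorem IsIsomorphic.finrank_eq {V W : QuiverRep k Q} (h : IsIsomorphic V W) (i : Q) :
    Module.finrank k (V.space i) = Module.finrank k (W.space i) := by
  obtain ⟨e⟩ := h
  exact (e.equiv i).finrank_eq

theorem IsIsomorphic.dimVec_eq {V W : QuiverRep k Q} (h : IsIsomorphic V W) :
    V.dimVec = W.dimVec := funext fun i => by simp only [dimVec, h.finrank_eq i]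

theorem IsIsomorphic.support_eq {V W : QuiverRep k Q} (h : IsIsomorphic V W) :
    V.support = W.support := by
  ext i
  simp only [support, Set.mem_ofPred_eq, h.finrank_eq i]

theorem isZero_iff_finrank {V : QuiverRep k Q} :
    V.IsZero ↔ ∀ i, Module.finrank k (V.space i) = 0 :=
  forall_congr' fun _ => Module.finrank_zero_iff.symm

theorem thin_not_isZero {I : Set Q} (hI : I.Nonempty) : ¬ (thin k I).IsZero := by
  classical
  obtain ⟨i, hi⟩ := hI
  intro h
  have := isZero_iff_finrank.1 h i
  rw [thin_finrank, if_pos hi] at this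
  exact one_ne_zero this

theorem IsIsomorphic.prod_congr {V V' W W' : QuiverRep k Q} (h : IsIsomorphic V V')
    (h' : IsIsomorphic W W') : IsIsomorphic (V.prod W) (V'.prod W') := by
  obtain ⟨e⟩ := h
  obtain ⟨f⟩ := h'
  refine ⟨⟨fun i => (e.equiv i).prodCongr (f.equiv i), fun {i j} a x => ?_⟩⟩
  exact Prod.ext (e.comm a x.1) (f.comm a x.2)

theorem IsIsomorphic.prod_of_isZero {V W : QuiverRep k Q} (h : W.IsZero) :
    IsIsomorphic (V.prod W) V := by
  refine ⟨⟨fun i => ?_, ?_⟩⟩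
  · have := h i
    exact LinearEquiv.ofBijective (LinearMap.fst k (V.space i) (W.space i))
      ⟨fun x y hxy => Prod.ext hxy (Subsingleton.elim _ _), LinearMap.fst_surjective⟩
  · intro i j a x
    rfl

theorem IsIsomorphic.directSum_congr {ι : Type} [Finite ι] {M N : ι → QuiverRep k Q}
    (h : ∀ x, IsIsomorphic (M x) (N x)) : IsIsomorphic (directSum M) (directSum N) := by
  refine ⟨⟨fun i => LinearEquiv.piCongrRight fun x => (h x).some.equiv i, fun {i j} a x => ?_⟩⟩
  funext y
  exact (h y).some.comm a (x y)

theorem IsIsomorphic.directSum_reindex {ι κ : Type} [Finite ι] [Finite κ] (e : κ ≃ ι)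
    (M : ι → QuiverRep k Q) : IsIsomorphic (directSum M) (directSum fun x => M (e x)) := by
  refine ⟨⟨fun i => (LinearEquiv.piCongrLeft k (fun x => (M x).space i) e).symm,
    fun {i j} a x => ?_⟩⟩
  funext y
  rfl

theorem IsIsomorphic.prod_directSum {ι : Type} [Finite ι] (V : QuiverRep k Q)
    (M : ι → QuiverRep k Q) :
    IsIsomorphic (V.prod (directSum M))
      (directSum fun x : Option ι => x.elim V M) := by
  refine ⟨⟨fun i => ?_, ?_⟩⟩
  · exact
    { toFun := fun x y => match y with
        | none => x.1
        | some y => x.2 y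
      invFun := fun x => ⟨x none, fun y => x (some y)⟩
      map_add' := fun a b => by funext y; cases y <;> rfl
      map_smul' := fun a b => by funext y; cases y <;> rfl
      left_inv := fun a => rfl
      right_inv := fun a => by funext y; cases y <;> rfl }
  · intro i j a x
    funext y
    cases y <;> rfl

end Thin

/-! ### Decomposition of representations of a linear quiver into intervals. -/

section Linear

/-- A quiver whose vertices sit at distinct natural numbers, with exactly one arrow between
vertices at consecutive positions, directed by `dir`, and no other arrows. -/
structure IsLinear (Q : Type v) [Quiver.{w} Q] (pos : Q → ℕ) (dir : ℕ → Bool) : Prop where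
  inj : Function.Injective pos
  arrow : ∀ {i j : Q}, (i ⟶ j) → (dir (pos i) = true ∧ pos j = pos i + 1) ∨
    (dir (pos j) = false ∧ pos i = pos j + 1)
  subsing : ∀ i j : Q, Subsingleton (i ⟶ j)
  exists_arrow : ∀ i j : Q, pos j = pos i + 1 →
    (dir (pos i) = true → Nonempty (i ⟶ j)) ∧ (dir (pos i) = false → Nonempty (j ⟶ i))

/-- The vertices at positions between `p.1` and `p.2`. -/
def interval {Q : Type v} (pos : Q → ℕ) (p : ℕ × ℕ) : Set Q := {i | p.1 ≤ pos i ∧ pos i ≤ p.2}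

/-- An interval of positions all of which carry a vertex. -/
def IsOccupied {Q : Type v} (pos : Q → ℕ) (p : ℕ × ℕ) : Prop :=
  p.1 ≤ p.2 ∧ ∀ q, p.1 ≤ q → q ≤ p.2 → ∃ i, pos i = q

theorem IsOccupied.nonempty {Q : Type v} {pos : Q → ℕ} {p : ℕ × ℕ} (hp : IsOccupied pos p) :
    (interval pos p).Nonempty := by
  obtain ⟨i, hi⟩ := hp.2 p.1 le_rfl hp.1
  exact ⟨i, hi.ge, hi.le.trans hp.1⟩

variable {k : Type u} [Field k] {Q : Type v} [Quiver.{w} Q] {pos : Q → ℕ} {dir : ℕ → Bool}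

/-- Vectors and functionals on the vertices of the interval `[a, b]` that form morphisms from and
to the interval representation, as far as arrows left of `b` are concerned, with composite `1`. -/
structure PartialSplit (V : QuiverRep k Q) (pos : Q → ℕ) (a b : ℕ) (x : ∀ i, V.space i)
    (ξ : ∀ i, Module.Dual k (V.space i)) : Prop where
  occ : ∀ q, a ≤ q → q ≤ b → ∃ i, pos i = q
  one : ∀ i ∈ interval pos (a, b), ξ i (x i) = 1
  zero : ∀ i ∉ interval pos (a, b), x i = 0 ∧ ξ i = 0
  comm : ∀ (i j : Q) (α : i ⟶ j), pos i ≤ b → pos j ≤ b → i ∈ interval pos (a, b) →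
    V.map α (x i) = x j
  comm' : ∀ (i j : Q) (α : i ⟶ j), pos i ≤ b → pos j ≤ b → j ∈ interval pos (a, b) →
    ξ j ∘ₗ V.map α = ξ i

theorem IsLinear.pos_ne (hQ : IsLinear Q pos dir) {i j : Q} (α : i ⟶ j) : i ≠ j := by
  rintro rfl
  rcases hQ.arrow α with h | h <;> omega

/-- The start of an interval at its left end `m`: `hx` and `hξ` say that nothing is passed on to, or
received from, the left neighbour. -/
theorem IsLinear.partialSplit_single (hQ : IsLinear Q pos dir) (V : QuiverRep k Q) (m : Q)
    (x : V.space m) (ξ : Module.Dual k (V.space m)) (h1 : ξ x = 1)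
    (hx : ∀ (j : Q) (α : m ⟶ j), pos j ≤ pos m → V.map α x = 0)
    (hξ : ∀ (i : Q) (α : i ⟶ m), pos i ≤ pos m → ξ ∘ₗ V.map α = 0) :
    ∃ (x' : ∀ i, V.space i) (ξ' : ∀ i, Module.Dual k (V.space i)),
      PartialSplit V pos (pos m) (pos m) x' ξ' ∧ x' m = x ∧ ξ' m = ξ := by
  classical
  have hm : ∀ i, i ∈ interval pos (pos m, pos m) ↔ i = m := fun i =>
    ⟨fun h => hQ.inj (le_antisymm h.2 h.1), fun h => h ▸ ⟨le_rfl, le_rfl⟩⟩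
  refine ⟨Pi.single m x, Pi.single m ξ, ⟨fun q h h' => ⟨m, le_antisymm h h'⟩, ?_, ?_, ?_, ?_⟩,
    Pi.single_eq_same _ _, Pi.single_eq_same _ _⟩
  · intro i hi
    obtain rfl := (hm i).1 hi
    simpa using h1
  · intro i hi
    rw [hm] at hi
    simp [hi]
  · intro i j α _ hj hi
    obtain rfl := (hm i).1 hi
    rw [Pi.single_eq_same, Pi.single_eq_of_ne (hQ.pos_ne α).symm, hx j α hj]
  · intro i j α hi _ hj
    obtain rfl := (hm j).1 hj
    rw [Pi.single_eq_same, Pi.single_eq_of_ne (hQ.pos_ne α), hξ i α hi]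

theorem IsLinear.eq_of_arrow_right (hQ : IsLinear Q pos dir) {i p m : Q} (hm : pos m = pos p + 1)
    (h : Nonempty (i ⟶ m) ∨ Nonempty (m ⟶ i)) (hi : pos i ≤ pos m) : i = p := by
  apply hQ.inj
  rcases h with ⟨⟨α⟩⟩ | ⟨⟨α⟩⟩ <;> rcases hQ.arrow α with h | h <;> omega

/-- Only one arrow joins the new vertex `m` to the vertices on its left, so compatibility along the
edge between `p` and `m` is all that has to be checked. -/
theorem IsLinear.partialSplit_extend (hQ : IsLinear Q pos dir) (V : QuiverRep k Q) {p m : Q}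
    (hm : pos m = pos p + 1) {a : ℕ} (hap : a ≤ pos p) {x : ∀ i, V.space i}
    {ξ : ∀ i, Module.Dual k (V.space i)} (hS : PartialSplit V pos a (pos p) x ξ)
    (xm : V.space m) (ξm : Module.Dual k (V.space m)) (h1 : ξm xm = 1)
    (hpm : ∀ α : p ⟶ m, V.map α (x p) = xm ∧ ξm ∘ₗ V.map α = ξ p)
    (hmp : ∀ α : m ⟶ p, V.map α xm = x p ∧ ξ p ∘ₗ V.map α = ξm) :
    ∃ (x' : ∀ i, V.space i) (ξ' : ∀ i, Module.Dual k (V.space i)),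
      PartialSplit V pos a (pos m) x' ξ' ∧ x' m = xm ∧ ξ' m = ξm := by
  classical
  have hne : p ≠ m := by rintro rfl; omega
  have hI : ∀ i, i ≠ m → (i ∈ interval pos (a, pos m) ↔ i ∈ interval pos (a, pos p)) := by
    intro i hi
    have : pos i ≠ pos m := fun h => hi (hQ.inj h)
    constructor <;> rintro ⟨h, h'⟩ <;> refine ⟨h, ?_⟩ <;> dsimp only at * <;> omega
  have hle : ∀ i, i ≠ m → pos i ≤ pos m → pos i ≤ pos p := by
    intro i hi h
    have : pos i ≠ pos m := fun h => hi (hQ.inj h)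
    omega
  refine ⟨Function.update x m xm, Function.update ξ m ξm, ⟨?_, ?_, ?_, ?_, ?_⟩,
    Function.update_self _ _ _, Function.update_self _ _ _⟩
  · intro q h h'
    rcases Nat.lt_or_ge q (pos m) with h2 | h2
    · exact hS.occ q h (by omega)
    · exact ⟨m, by omega⟩
  · intro i hi
    by_cases him : i = m
    · subst him
      simpa using h1
    · rw [Function.update_of_ne him, Function.update_of_ne him]
      exact hS.one i ((hI i him).1 hi)
  · intro i hi
    by_cases him : i = m
    · subst him
      exact absurd ⟨by dsimp only; omega, le_rfl⟩ hi
    · rw [Function.update_of_ne him, Function.update_of_ne him]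
      exact hS.zero i fun h => hi ((hI i him).2 h)
  · intro i j α hi hj hiI
    by_cases him : i = m
    · subst him
      obtain rfl := hQ.eq_of_arrow_right hm (Or.inr ⟨α⟩) hj
      rw [Function.update_self, Function.update_of_ne hne, (hmp α).1]
    · by_cases hjm : j = m
      · subst hjm
        obtain rfl := hQ.eq_of_arrow_right hm (Or.inl ⟨α⟩) hi
        rw [Function.update_self, Function.update_of_ne hne, (hpm α).1]
      · rw [Function.update_of_ne him, Function.update_of_ne hjm]
        exact hS.comm i j α (hle i him hi) (hle j hjm hj) ((hI i him).1 hiI)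
  · intro i j α hi hj hjI
    by_cases him : i = m
    · subst him
      obtain rfl := hQ.eq_of_arrow_right hm (Or.inr ⟨α⟩) hj
      rw [Function.update_self, Function.update_of_ne hne, (hmp α).2]
    · by_cases hjm : j = m
      · subst hjm
        obtain rfl := hQ.eq_of_arrow_right hm (Or.inl ⟨α⟩) hi
        rw [Function.update_self, Function.update_of_ne hne, (hpm α).2]
      · rw [Function.update_of_ne him, Function.update_of_ne hjm]
        exact hS.comm' i j α (hle i him hi) (hle j hjm hj) ((hI j hjm).1 hjI)

theorem exists_dual_eq_one {E : Type*} [AddCommGroup E] [Module k E] {A : Submodule k E} {x : E}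
    (hx : x ∉ A) : ∃ ξ : Module.Dual k E, ξ x = 1 ∧ ∀ y ∈ A, ξ y = 0 := by
  obtain ⟨f, hf, hA⟩ := Submodule.exists_le_ker_of_notMem hx
  refine ⟨(f x)⁻¹ • f, ?_, fun y hy => ?_⟩
  · simp [hf]
  · have : f y = 0 := hA hy
    simp [this]

/-- A functional on the source of `f` vanishing on the preimage of `A` is induced by a functional
vanishing on `A`. -/
theorem exists_dual_extension {E F : Type*} [AddCommGroup E] [Module k E] [AddCommGroup F]
    [Module k F] (f : E →ₗ[k] F) (A : Submodule k F) (ξ : Module.Dual k E)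
    (hξ : ∀ y ∈ A.comap f, ξ y = 0) : ∃ η : Module.Dual k F, η ∘ₗ f = ξ ∧ ∀ y ∈ A, η y = 0 := by
  have hker : LinearMap.ker (A.mkQ ∘ₗ f) ≤ LinearMap.ker ξ := by
    intro y hy
    refine hξ y ?_
    have : A.mkQ (f y) = 0 := hy
    simpa using this
  obtain ⟨g, hg⟩ := LinearMap.exists_extend
    ((LinearMap.ker (A.mkQ ∘ₗ f)).liftQ ξ hker ∘ₗ
      (A.mkQ ∘ₗ f).quotKerEquivRange.symm.toLinearMap)
  refine ⟨g ∘ₗ A.mkQ, ?_, fun y hy => ?_⟩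
  · ext y
    have := LinearMap.congr_fun hg ⟨(A.mkQ ∘ₗ f) y, LinearMap.mem_range_self _ y⟩
    have h2 : (A.mkQ ∘ₗ f).quotKerEquivRange.symm ⟨(A.mkQ ∘ₗ f) y, LinearMap.mem_range_self _ y⟩
        = Submodule.Quotient.mk y := by
      rw [LinearEquiv.symm_apply_eq]
      rfl
    refine Eq.trans this ?_
    change (LinearMap.ker (A.mkQ ∘ₗ f)).liftQ ξ hker ((A.mkQ ∘ₗ f).quotKerEquivRange.symm _) = _
    rw [h2]
    rfl
  · have : A.mkQ y = 0 := by simpa using hy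
    simp [this]

/-- A nonzero vector of the subquotient `B / A` at `m` is traced to the left as far as it goes. The
two subspaces are what makes the induction run: the subquotient is pulled back along an arrow `p ⟶
m`, or pushed forward along `m ⟶ p`, and stays a subquotient at `p`. If a class of `B / A` can be
cut off from the left neighbour, the interval starts at `m`. -/
theorem IsLinear.exists_partialSplit (hQ : IsLinear Q pos dir) (V : QuiverRep k Q) (n : ℕ) :
    ∀ m : Q, pos m = n → ∀ A B : Submodule k (V.space m), A ≤ B → ¬ B ≤ A →
    ∃ a ≤ pos m, ∃ (x : ∀ i, V.space i) (ξ : ∀ i, Module.Dual k (V.space i)),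
      PartialSplit V pos a (pos m) x ξ ∧ x m ∈ B ∧ ∀ y ∈ A, ξ m y = 0 := by
  induction n with
  | zero =>
    intro m hm A B hle hAB
    obtain ⟨x, hxB, hxA⟩ := Set.not_subset.1 hAB
    obtain ⟨ξ, h1, hA⟩ := exists_dual_eq_one hxA
    obtain ⟨x', ξ', hS, rfl, rfl⟩ := hQ.partialSplit_single V m x ξ h1
      (fun j α hj => absurd (hQ.inj (by omega)) (hQ.pos_ne α))
      (fun i α hi => absurd (hQ.inj (by omega)) (hQ.pos_ne α))
    exact ⟨pos m, le_rfl, x', ξ', hS, hxB, hA⟩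
  | succ n ih =>
    intro m hm A B hle hAB
    by_cases hp : ∃ p, pos p = n
    · obtain ⟨p, hp⟩ := hp
      have hpm : pos m = pos p + 1 := by omega
      obtain ⟨ho, ho'⟩ := hQ.exists_arrow p m hpm
      cases hd : dir (pos p) with
      | true =>
        obtain ⟨f⟩ := ho hd
        have hsub := hQ.subsing p m
        have hno : IsEmpty (m ⟶ p) := ⟨fun α => by
          rcases hQ.arrow α with h | h
          · omega
          · simp [hd] at h⟩
        -- If every class of `B / A` comes from `p`, the preimages of `A` and `B` still differ and
        -- the interval is continued. Otherwise some `x ∈ B` is separated from both `A` and the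
        -- image of `f` by a functional, and a new interval starts.
        by_cases hc : B ≤ A ⊔ LinearMap.range (V.map f)
        · have hAB' : ¬ B.comap (V.map f) ≤ A.comap (V.map f) := by
            intro hle'
            apply hAB
            intro y hy
            obtain ⟨s, hs, t, ⟨z, rfl⟩, rfl⟩ := Submodule.mem_sup.1 (hc hy)
            have hz : z ∈ B.comap (V.map f) := by
              rw [Submodule.mem_comap]
              simpa using B.sub_mem hy (hle hs)
            exact A.add_mem hs (hle' hz)
          obtain ⟨a, ha, x, ξ, hS, hxB, hξA⟩ := ih p hp _ _ (Submodule.comap_mono hle) hAB'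
          obtain ⟨ξm, hξm, hξmA⟩ := exists_dual_extension (V.map f) A (ξ p) hξA
          have h1 : ξm (V.map f (x p)) = 1 := by
            rw [← LinearMap.comp_apply, hξm]
            exact hS.one p ⟨ha, le_rfl⟩
          obtain ⟨x', ξ', hS', hx', rfl⟩ := hQ.partialSplit_extend V hpm ha hS (V.map f (x p)) ξm h1
            (fun α => by rw [Subsingleton.elim α f]; exact ⟨rfl, hξm⟩) (fun α => hno.elim α)
          exact ⟨a, by omega, x', ξ', hS', hx' ▸ hxB, hξmA⟩
        · obtain ⟨x, hxB, hxA⟩ := Set.not_subset.1 hc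
          obtain ⟨ξ, h1, hA⟩ := exists_dual_eq_one hxA
          obtain ⟨x', ξ', hS, rfl, rfl⟩ := hQ.partialSplit_single V m x ξ h1
            (fun j α hj => by
              obtain rfl := hQ.eq_of_arrow_right hpm (Or.inr ⟨α⟩) hj
              exact hno.elim α)
            (fun i α hi => by
              obtain rfl := hQ.eq_of_arrow_right hpm (Or.inl ⟨α⟩) hi
              rw [Subsingleton.elim α f]
              ext y
              exact hA _ (Submodule.mem_sup_right (LinearMap.mem_range_self _ y)))
          exact ⟨pos m, le_rfl, x', ξ', hS, hxB, fun y hy => hA y (Submodule.mem_sup_left hy)⟩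
      | false =>
        obtain ⟨g⟩ := ho' hd
        have hsub := hQ.subsing m p
        have hno : IsEmpty (p ⟶ m) := ⟨fun α => by
          rcases hQ.arrow α with h | h
          · simp [hd] at h
          · omega⟩
        -- The dual alternative: if the kernel contributes nothing modulo `A`, the images of `A` and
        -- `B` still differ. Otherwise an `x ∈ B` outside `A` killed by `g` starts a new interval.
        by_cases hc : B ⊓ LinearMap.ker (V.map g) ≤ A
        · have hAB' : ¬ B.map (V.map g) ≤ A.map (V.map g) := by
            intro hle'
            apply hAB
            intro y hy
            obtain ⟨z, hz, hzy⟩ := hle' (Submodule.mem_map_of_mem hy)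
            have : y - z ∈ A := hc ⟨B.sub_mem hy (hle hz), by simp [hzy]⟩
            simpa using A.add_mem this hz
          obtain ⟨a, ha, x, ξ, hS, ⟨xm, hxB, hxm⟩, hξA⟩ :=
            ih p hp _ _ (Submodule.map_mono hle) hAB'
          have h1 : (ξ p ∘ₗ V.map g) xm = 1 := by
            rw [LinearMap.comp_apply, hxm]
            exact hS.one p ⟨ha, le_rfl⟩
          obtain ⟨x', ξ', hS', rfl, hξ'⟩ := hQ.partialSplit_extend V hpm ha hS xm _ h1
            (fun α => hno.elim α) (fun α => by rw [Subsingleton.elim α g]; exact ⟨hxm, rfl⟩)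
          refine ⟨a, by omega, x', ξ', hS', hxB, fun y hy => ?_⟩
          rw [hξ', LinearMap.comp_apply]
          exact hξA _ (Submodule.mem_map_of_mem hy)
        · obtain ⟨x, ⟨hxB, hxg⟩, hxA⟩ := Set.not_subset.1 hc
          obtain ⟨ξ, h1, hA⟩ := exists_dual_eq_one hxA
          obtain ⟨x', ξ', hS, rfl, rfl⟩ := hQ.partialSplit_single V m x ξ h1
            (fun j α hj => by
              obtain rfl := hQ.eq_of_arrow_right hpm (Or.inr ⟨α⟩) hj
              rw [Subsingleton.elim α g]
              exact hxg)
            (fun i α hi => by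
              obtain rfl := hQ.eq_of_arrow_right hpm (Or.inl ⟨α⟩) hi
              exact hno.elim α)
          exact ⟨pos m, le_rfl, x', ξ', hS, hxB, hA⟩
    · obtain ⟨x, hxB, hxA⟩ := Set.not_subset.1 hAB
      obtain ⟨ξ, h1, hA⟩ := exists_dual_eq_one hxA
      obtain ⟨x', ξ', hS, rfl, rfl⟩ := hQ.partialSplit_single V m x ξ h1
        (fun j α hj => absurd ⟨j, by rcases hQ.arrow α with h | h <;> omega⟩ hp)
        (fun i α hi => absurd ⟨i, by rcases hQ.arrow α with h | h <;> omega⟩ hp)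
      exact ⟨pos m, le_rfl, x', ξ', hS, hxB, hA⟩

/-- The summand complementary to an interval summand. -/
noncomputable def kerRep (V : QuiverRep k Q) (ξ : ∀ i, Module.Dual k (V.space i))
    (h : ∀ (i j : Q) (α : i ⟶ j) (y : V.space i), ξ i y = 0 → ξ j (V.map α y) = 0) :
    QuiverRep k Q where
  space i := LinearMap.ker (ξ i)
  map {i j} α := (V.map α).restrict fun y hy => h i j α y hy

/-- The vectors `x` form a morphism from the thin representation, the functionals `ξ` a morphism
back, and the composite is the identity; the complement is the kernel of `ξ`. -/
theorem isIsomorphic_thin_prod_kerRep (V : QuiverRep k Q) (I : Set Q) (x : ∀ i, V.space i)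
    (ξ : ∀ i, Module.Dual k (V.space i)) (h1 : ∀ i ∈ I, ξ i (x i) = 1)
    (h0 : ∀ i ∉ I, x i = 0 ∧ ξ i = 0)
    (hc : ∀ (i j : Q) (α : i ⟶ j), i ∈ I → V.map α (x i) = x j)
    (hc' : ∀ (i j : Q) (α : i ⟶ j), j ∈ I → ξ j ∘ₗ V.map α = ξ i) :
    ∃ K : QuiverRep k Q, IsIsomorphic V ((thin k I).prod K) := by
  have hker : ∀ (i j : Q) (α : i ⟶ j) (y : V.space i), ξ i y = 0 → ξ j (V.map α y) = 0 := by
    intro i j α y hy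
    by_cases hj : j ∈ I
    · rw [← LinearMap.comp_apply, hc' i j α hj, hy]
    · simp [(h0 j hj).2]
  refine ⟨kerRep V ξ hker, IsIsomorphic.symm ⟨⟨fun i => ?_, ?_⟩⟩⟩
  · refine LinearEquiv.ofBijective (LinearMap.coprod
      ((LinearMap.toSpanSingleton k (V.space i) (x i)) ∘ₗ (scalarsOn k (i ∈ I)).subtype)
      (LinearMap.ker (ξ i)).subtype) ⟨?_, ?_⟩
    · rw [← LinearMap.ker_eq_bot, LinearMap.ker_eq_bot']
      rintro ⟨⟨c, hcI⟩, ⟨y, hy⟩⟩ h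
      have h' : c • x i + y = 0 := h
      have hc0 : c = 0 := by
        by_cases hi : i ∈ I
        · have := congrArg (ξ i) h'
          simpa [h1 i hi, LinearMap.mem_ker.1 hy] using this
        · exact hcI hi
      subst hc0
      have hy0 : y = 0 := by simpa using h'
      subst hy0
      rfl
    · intro y
      refine ⟨⟨⟨ξ i y, fun hi => by simp [(h0 i hi).2]⟩, ⟨y - ξ i y • x i, ?_⟩⟩, ?_⟩
      · by_cases hi : i ∈ I
        · simp [h1 i hi]
        · simp [(h0 i hi).2]
      · change ξ i y • x i + (y - ξ i y • x i) = y
        abel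
  · classical
    rintro i j α ⟨⟨c, hcI⟩, ⟨y, hy⟩⟩
    change (if j ∈ I then c else 0) • x j + V.map α y = V.map α (c • x i + y)
    rw [map_add, map_smul]
    congr 1
    by_cases hi : i ∈ I
    · rw [hc i j α hi]
      split_ifs with hj
      · rfl
      · simp [(h0 j hj).1]
    · simp [hcI hi]

theorem IsLinear.exists_thin_summand [Finite Q] (hQ : IsLinear Q pos dir) (V : QuiverRep k Q)
    (hV : ¬ V.IsZero) : ∃ p, IsOccupied pos p ∧
      ∃ K : QuiverRep k Q, IsIsomorphic V ((thin k (interval pos p)).prod K) := by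
  have hne : {i | ¬ Subsingleton (V.space i)}.Nonempty := by
    simpa [IsZero, Set.Nonempty] using hV
  -- With `m` the rightmost vertex where `V` is nonzero, compatibility along arrows to the right of
  -- `m` is automatic, so a partial splitting up to `m` is a splitting.
  obtain ⟨m, hm, hmax⟩ := Set.exists_max_image _ pos (Set.toFinite _) hne
  have hsub : ∀ i, pos m < pos i → Subsingleton (V.space i) := by
    intro i hi
    by_contra h
    exact absurd (hmax i h) (by omega)
  have hm' : ¬ (⊤ : Submodule k (V.space m)) ≤ ⊥ := by
    intro h
    refine hm ⟨fun y z => ?_⟩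
    rw [(Submodule.mem_bot k).1 (h (Submodule.mem_top (x := y))),
      (Submodule.mem_bot k).1 (h (Submodule.mem_top (x := z)))]
  obtain ⟨a, ha, x, ξ, hS, -, -⟩ := hQ.exists_partialSplit V _ m rfl ⊥ ⊤ bot_le hm'
  refine ⟨(a, pos m), ⟨ha, hS.occ⟩, isIsomorphic_thin_prod_kerRep V _ x ξ hS.one hS.zero ?_ ?_⟩
  · intro i j α hi
    by_cases hj : pos j ≤ pos m
    · exact hS.comm i j α hi.2 hj hi
    · have := hsub j (by omega)
      exact Subsingleton.elim _ _
  · intro i j α hj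
    by_cases hi : pos i ≤ pos m
    · exact hS.comm' i j α hi hj.2 hj
    · have := hsub i (by omega)
      exact Subsingleton.elim _ _

theorem finrank_prod (V W : QuiverRep k Q) (i : Q) :
    Module.finrank k ((V.prod W).space i) =
      Module.finrank k (V.space i) + Module.finrank k (W.space i) :=
  Module.finrank_prod

theorem IsLinear.exists_directSum_thin [Fintype Q] (hQ : IsLinear Q pos dir) (n : ℕ) :
    ∀ V : QuiverRep k Q, ∑ i, Module.finrank k (V.space i) = n →
    ∃ (ι : Type) (_ : Fintype ι) (p : ι → ℕ × ℕ), (∀ y, IsOccupied pos (p y)) ∧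
      IsIsomorphic V (directSum fun y => thin k (interval pos (p y))) := by
  induction n using Nat.strong_induction_on with
  | _ n ih =>
    intro V hV
    by_cases h0 : V.IsZero
    · refine ⟨Empty, inferInstance, Empty.elim, fun y => y.elim, ⟨⟨fun i => ?_, ?_⟩⟩⟩
      · have := h0 i
        exact
          { (0 : V.space i →ₗ[k] _) with
            invFun := 0
            left_inv := fun _ => Subsingleton.elim _ _
            right_inv := fun _ => funext fun y => y.elim }
      · intro i j a x
        funext y
        exact y.elim
    · obtain ⟨p, hp, K, hK⟩ := hQ.exists_thin_summand V h0
      obtain ⟨i, hi⟩ := hp.nonempty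
      have hlt : ∑ i, Module.finrank k (K.space i) < n := by
        rw [← hV]
        refine Finset.sum_lt_sum (fun j _ => ?_) ⟨i, Finset.mem_univ _, ?_⟩
        · rw [hK.finrank_eq, finrank_prod]
          exact Nat.le_add_left _ _
        · classical
          rw [hK.finrank_eq, finrank_prod, thin_finrank, if_pos hi]
          omega
      obtain ⟨ι, _, q, hq, hKq⟩ := ih _ hlt K rfl
      refine ⟨Option ι, inferInstance, fun y => y.elim p q, ?_, ?_⟩
      · rintro (_ | y)
        · exact hp
        · exact hq y
      · refine (hK.trans ((IsIsomorphic.refl _).prod_congr hKq)).trans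
          ((IsIsomorphic.prod_directSum _ _).trans (IsIsomorphic.directSum_congr ?_))
        rintro (_ | y)
        · exact IsIsomorphic.refl _
        · exact IsIsomorphic.refl _

theorem IsLinear.indecomposable_isIsomorphic_thin [Finite Q] (hQ : IsLinear Q pos dir)
    {V : QuiverRep k Q} (hV : V.IsIndecomposable) :
    ∃ p, IsOccupied pos p ∧ IsIsomorphic V (thin k (interval pos p)) := by
  obtain ⟨p, hp, K, hK⟩ := hQ.exists_thin_summand V hV.1
  refine ⟨p, hp, hK.trans (IsIsomorphic.prod_of_isZero ?_)⟩
  exact (hV.2 _ _ hK).resolve_left (thin_not_isZero hp.nonempty)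

end Linear

end QuiverRep

namespace QuiverRep

/-! ### Retracts and the combinatorial form of `Ext¹ = 0`. -/

section Retract

variable {k : Type u} [Field k] {Q : Type v} [Quiver.{w} Q]

/-- `V` is a retract of `W`. -/
def IsRetract (V W : QuiverRep k Q) : Prop :=
  ∃ (s : ∀ i, V.space i →ₗ[k] W.space i) (r : ∀ i, W.space i →ₗ[k] V.space i),
    (∀ i x, r i (s i x) = x) ∧
    (∀ (i j : Q) (α : i ⟶ j) x, s j (V.map α x) = W.map α (s i x)) ∧
    (∀ (i j : Q) (α : i ⟶ j) x, r j (W.map α x) = V.map α (r i x))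

theorem IsRetract.trans {V W X : QuiverRep k Q} (h : IsRetract V W) (h' : IsRetract W X) :
    IsRetract V X := by
  obtain ⟨s, r, h1, h2, h3⟩ := h
  obtain ⟨s', r', h1', h2', h3'⟩ := h'
  exact ⟨fun i => s' i ∘ₗ s i, fun i => r i ∘ₗ r' i, fun i x => by simp [h1, h1'],
    fun i j α x => by simp [h2, h2'], fun i j α x => by simp [h3, h3']⟩

theorem IsIsomorphic.isRetract {V W : QuiverRep k Q} (h : IsIsomorphic V W) : IsRetract V W := by
  obtain ⟨e⟩ := h
  refine ⟨fun i => e.equiv i, fun i => (e.equiv i).symm, fun i x => by simp,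
    fun i j α x => by simp [e.comm], fun i j α x => ?_⟩
  simp only [LinearEquiv.coe_coe, LinearEquiv.symm_apply_eq, e.comm, LinearEquiv.apply_symm_apply]

theorem isRetract_directSum {ι : Type} [Finite ι] (M : ι → QuiverRep k Q) (y : ι) :
    IsRetract (M y) (directSum M) := by
  classical
  refine ⟨fun i => LinearMap.single k (fun x => (M x).space i) y,
    fun i => LinearMap.proj y, fun i x => Pi.single_eq_same (M := fun x => (M x).space i) y x, fun i j α x => ?_,
    fun _ _ _ _ => rfl⟩
  funext z
  change Pi.single (M := fun x => (M x).space j) y ((M y).map α x) z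
    = (M z).map α (Pi.single (M := fun x => (M x).space i) y x z)
  by_cases hz : z = y
  · subst hz
    rw [Pi.single_eq_same, Pi.single_eq_same]
  · rw [Pi.single_eq_of_ne hz, Pi.single_eq_of_ne hz, map_zero]

theorem isRigid_iff (V : QuiverRep k Q) : V.IsRigid ↔ Function.Surjective (extMap V V) := by
  rw [IsRigid, Ext1, Submodule.Quotient.subsingleton_iff, LinearMap.range_eq_top]

theorem extMap_apply (V W : QuiverRep k Q) (f : ∀ i : Q, V.space i →ₗ[k] W.space i) (i j : Q)
    (α : i ⟶ j) (x : V.space i) :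
    extMap V W f i j α x = f j (V.map α x) - W.map α (f i x) := rfl

/-- Functoriality of `Ext¹` made explicit: a family of maps is moved to the large representations by
`r` and `s'`, solved there, and the solution is moved back by `s` and `r'`. -/
theorem extMap_surjective_of_isRetract {V V' W W' : QuiverRep k Q} (hV : IsRetract V V')
    (hW : IsRetract W W') (h : Function.Surjective (extMap V' W')) :
    Function.Surjective (extMap V W) := by
  obtain ⟨s, r, h1, h2, h3⟩ := hV
  obtain ⟨s', r', h1', h2', h3'⟩ := hW
  intro g
  obtain ⟨f, hf⟩ := h fun i j α => s' j ∘ₗ g i j α ∘ₗ r i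
  refine ⟨fun i => r' i ∘ₗ f i ∘ₗ s i, ?_⟩
  funext i j α
  ext x
  have := congrArg (r' j) (LinearMap.congr_fun (congrFun (congrFun (congrFun hf i) j) α) (s i x))
  rw [extMap_apply] at this
  rw [extMap_apply]
  simpa [h1, h1', h2, h3'] using this

/-- The combinatorial form of `Ext¹(M_p, M_q) = 0` for the interval representations `M_p`, `M_q`
of the linear quiver with orientation `dir`. -/
def ExtVanishes (k : Type u) [Field k] (dir : ℕ → Bool) (p q : ℕ × ℕ) : Prop :=
  ∀ g : ℕ → k, ∃ F : ℕ → k, ∀ e : ℕ,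
    (dir e = true → e ∈ Set.Icc p.1 p.2 → e + 1 ∈ Set.Icc q.1 q.2 →
      (Set.Icc p.1 p.2).indicator F (e + 1) - (Set.Icc q.1 q.2).indicator F e = g e) ∧
    (dir e = false → e + 1 ∈ Set.Icc p.1 p.2 → e ∈ Set.Icc q.1 q.2 →
      (Set.Icc p.1 p.2).indicator F e - (Set.Icc q.1 q.2).indicator F (e + 1) = g e)

variable {pos : Q → ℕ} {dir : ℕ → Bool}

theorem map_thinOne {I : Set Q} {i j : Q} (hi : i ∈ I) (α : i ⟶ j) :
    (thin k I).map α (thinOne k I i) = thinOne k I j := by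
  classical
  apply Subtype.ext
  change (if j ∈ I then (if i ∈ I then (1 : k) else 0) else 0) = if j ∈ I then (1 : k) else 0
  rw [if_pos hi]

open Classical in
theorem extVanishes_of_surjective (hQ : IsLinear Q pos dir) {p q : ℕ × ℕ}
    (hp : IsOccupied pos p) (hq : IsOccupied pos q)
    (h : Function.Surjective (extMap (thin k (interval pos p)) (thin k (interval pos q)))) :
    ExtVanishes k dir p q := by
  intro g
  -- The edge between `e` and `e + 1` carries the label `e`, the smaller of its two positions. The
  -- unknown scalars are read off from `f` at the vectors `1`.
  obtain ⟨f, hf⟩ := h fun i j _ => g (min (pos i) (pos j)) •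
    scalarsOnMap k (i ∈ interval pos p) (j ∈ interval pos q)
  let F' : Q → k := fun i => Subtype.val (p := (· ∈ scalarsOn k (i ∈ interval pos q)))
    (f i (thinOne k (interval pos p) i))
  have key : ∀ (i j : Q) (α : i ⟶ j), i ∈ interval pos p → j ∈ interval pos q →
      (if j ∈ interval pos p then F' j else 0) - (if i ∈ interval pos q then F' i else 0)
        = g (min (pos i) (pos j)) := by
    intro i j α hi hj
    have h1 := LinearMap.congr_fun (congrFun (congrFun (congrFun hf i) j) α)
      (thinOne k (interval pos p) i)
    rw [extMap_apply, map_thinOne hi] at h1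
    have h2 := congrArg (Subtype.val (p := (· ∈ scalarsOn k (j ∈ interval pos q)))) h1
    have h3 : F' j - (if j ∈ interval pos q then F' i else 0) = g (min (pos i) (pos j)) *
      (if j ∈ interval pos q then (if i ∈ interval pos p then 1 else 0) else 0) := h2
    rw [if_pos hj, if_pos hj, if_pos hi, mul_one] at h3
    rw [← h3]
    congr 1
    · split_ifs with h4
      · rfl
      · have : thinOne k (interval pos p) j = 0 := by
          apply Subtype.ext
          rw [thinOne_val, if_neg h4]
          rfl
        simp only [F', this, map_zero]
        rfl
    · split_ifs with h4
      · rfl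
      · exact ((f i (thinOne k (interval pos p) i)).2 h4).symm
  refine ⟨fun e => if h : ∃ i, pos i = e then F' h.choose else 0, fun e => ?_⟩
  have hF : ∀ i : Q, (fun e => if h : ∃ i, pos i = e then F' h.choose else 0) (pos i) = F' i := by
    intro i
    have : ∃ j, pos j = pos i := ⟨i, rfl⟩
    dsimp only
    rw [dif_pos this, hQ.inj this.choose_spec]
  have hind : ∀ (r : ℕ × ℕ) (i : Q), (Set.Icc r.1 r.2).indicator
      (fun e => if h : ∃ i, pos i = e then F' h.choose else 0) (pos i) =
      if i ∈ interval pos r then F' i else 0 := by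
    intro r i
    rw [Set.indicator_apply]
    refine (congrArg (fun c => if pos i ∈ Set.Icc r.1 r.2 then c else 0) (hF i)).trans ?_
    exact if_congr Iff.rfl rfl rfl
  constructor
  · intro hd h1 h2
    obtain ⟨i, rfl⟩ := hp.2 e h1.1 h1.2
    obtain ⟨j, hj⟩ := hq.2 _ h2.1 h2.2
    obtain ⟨α⟩ := (hQ.exists_arrow i j hj).1 hd
    rw [← hj] at h2 ⊢
    rw [hind, hind, key i j α h1 h2]
    congr
    omega
  · intro hd h1 h2
    obtain ⟨i, hi⟩ := hp.2 _ h1.1 h1.2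
    obtain ⟨j, rfl⟩ := hq.2 _ h2.1 h2.2
    obtain ⟨α⟩ := (hQ.exists_arrow j i hi).2 hd
    rw [← hi] at h1 ⊢
    rw [hind, hind, key i j α h1 h2]
    congr
    omega

/-- In a decomposition `A ⊕ B` the dimensions add up to 1 at each vertex of the interval, and the
arrows inside it act injectively. So neither dimension decreases along an arrow while the sum is
constant: both are constant on the interval, and one of them vanishes. -/
theorem IsLinear.thin_isIndecomposable (hQ : IsLinear Q pos dir) {p : ℕ × ℕ}
    (hp : IsOccupied pos p) : (thin k (interval pos p)).IsIndecomposable := by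
  classical
  refine ⟨thin_not_isZero hp.nonempty, fun A B hAB => ?_⟩
  have hsum : ∀ i, Module.finrank k (A.space i) + Module.finrank k (B.space i) =
      if i ∈ interval pos p then 1 else 0 := by
    intro i
    rw [← finrank_prod, ← hAB.finrank_eq, thin_finrank]
  have hinj : ∀ (i j : Q) (α : i ⟶ j), i ∈ interval pos p → j ∈ interval pos p →
      Function.Injective ((A.prod B).map α) := by
    obtain ⟨e⟩ := hAB
    intro i j α hi hj
    have : ((A.prod B).map α : _ → _) = e.equiv j ∘ (thin k (interval pos p)).map α ∘
        (e.equiv i).symm := by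
      funext x
      simp [e.comm]
    rw [this]
    refine (e.equiv j).injective.comp (Function.Injective.comp ?_ (e.equiv i).symm.injective)
    intro x y hxy
    apply Subtype.ext
    have h2 := congrArg (Subtype.val (p := (· ∈ scalarsOn k (j ∈ interval pos p)))) hxy
    change (if j ∈ interval pos p then x.1 else 0) = if j ∈ interval pos p then y.1 else 0 at h2
    rwa [if_pos hj, if_pos hj] at h2
  have hstep : ∀ (i j : Q) (α : i ⟶ j), i ∈ interval pos p → j ∈ interval pos p →
      Module.finrank k (A.space i) = Module.finrank k (A.space j) := by
    intro i j α hi hj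
    have hA : Module.finrank k (A.space i) ≤ Module.finrank k (A.space j) := by
      refine LinearMap.finrank_le_finrank_of_injective (f := A.map α) fun x y hxy => ?_
      have : ((x, 0) : A.space i × B.space i) = (y, 0) :=
        hinj i j α hi hj (Prod.ext hxy rfl)
      exact congrArg Prod.fst this
    have hB : Module.finrank k (B.space i) ≤ Module.finrank k (B.space j) := by
      refine LinearMap.finrank_le_finrank_of_injective (f := B.map α) fun x y hxy => ?_
      have : ((0, x) : A.space i × B.space i) = (0, y) :=
        hinj i j α hi hj (Prod.ext rfl hxy)
      exact congrArg Prod.snd this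
    have h1 := hsum i
    have h2 := hsum j
    rw [if_pos hi] at h1
    rw [if_pos hj] at h2
    omega
  obtain ⟨i₀, hi₀⟩ := hp.2 p.1 le_rfl hp.1
  have hconst : ∀ q, p.1 ≤ q → q ≤ p.2 → ∀ i, pos i = q →
      Module.finrank k (A.space i) = Module.finrank k (A.space i₀) := by
    intro q hq
    induction q, hq using Nat.le_induction with
    | base =>
      intro _ i hi
      rw [hQ.inj (hi.trans hi₀.symm)]
    | succ q hq ih =>
      intro hq2 i hi
      obtain ⟨j, hj⟩ := hp.2 q hq (by omega)
      rw [← ih (by omega) j hj]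
      have hiI : i ∈ interval pos p := ⟨by omega, by omega⟩
      have hjI : j ∈ interval pos p := ⟨by omega, by omega⟩
      obtain ⟨h1, h2⟩ := hQ.exists_arrow j i (by omega)
      cases hd : dir (pos j) with
      | true =>
        obtain ⟨α⟩ := h1 hd
        exact (hstep j i α hjI hiI).symm
      | false =>
        obtain ⟨α⟩ := h2 hd
        exact hstep i j α hiI hjI
  rw [isZero_iff_finrank, isZero_iff_finrank]
  have h0 := hsum i₀
  rw [if_pos ⟨hi₀.ge, hi₀.le.trans hp.1⟩] at h0
  rcases Nat.eq_zero_or_pos (Module.finrank k (A.space i₀)) with h | h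
  · left
    intro i
    by_cases hi : i ∈ interval pos p
    · rw [hconst (pos i) hi.1 hi.2 i rfl, h]
    · have := hsum i
      rw [if_neg hi] at this
      omega
  · right
    intro i
    have := hsum i
    by_cases hi : i ∈ interval pos p
    · rw [if_pos hi, hconst (pos i) hi.1 hi.2 i rfl] at this
      omega
    · rw [if_neg hi] at this
      omega

end Retract

/-! ### Comparison of a representation with its restriction to the support. -/

section Restrict

variable {k : Type u} [Field k] {Q : Type v} [Quiver.{w} Q]

theorem subsingleton_of_notMem_support {V : QuiverRep k Q} {i : Q} (h : i ∉ V.support) :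
    Subsingleton (V.space i) :=
  Module.finrank_zero_iff.1 (not_not.1 h)

open Classical in
theorem IsIsomorphic.of_restrict {V W : QuiverRep k Q} {S : Set Q} (hV : V.support ⊆ S)
    (hW : W.support ⊆ S) (h : IsIsomorphic (V.restrict S) (W.restrict S)) :
    IsIsomorphic V W := by
  obtain ⟨E, hE⟩ : ∃ E : ∀ i, i ∈ S → (V.space i ≃ₗ[k] W.space i), ∀ (i j : Q) (α : i ⟶ j)
      (hi : i ∈ S) (hj : j ∈ S) (x : V.space i), E j hj (V.map α x) = W.map α (E i hi x) := by
    obtain ⟨e⟩ := h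
    exact ⟨fun i h => e.equiv ⟨i, h⟩,
      fun i j α hi hj x => e.comm (i := ⟨i, hi⟩) (j := ⟨j, hj⟩) α x⟩
  have hV' : ∀ i ∉ S, Subsingleton (V.space i) := fun i hi =>
    subsingleton_of_notMem_support fun h => hi (hV h)
  have hW' : ∀ i ∉ S, Subsingleton (W.space i) := fun i hi =>
    subsingleton_of_notMem_support fun h => hi (hW h)
  refine ⟨⟨fun i => if h : i ∈ S then E i h else
    { (0 : V.space i →ₗ[k] W.space i) with
      invFun := 0
      left_inv := fun _ => (hV' i h).elim _ _
      right_inv := fun _ => (hW' i h).elim _ _ }, fun {i j} α x => ?_⟩⟩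
  by_cases hi : i ∈ S
  · by_cases hj : j ∈ S
    · rw [dif_pos hi, dif_pos hj]
      exact hE i j α hi hj x
    · exact (hW' j hj).elim _ _
  · rw [(hV' i hi).elim x 0]
    simp

open Classical in
theorem IsRigid.of_restrict {V : QuiverRep k Q} {S : Set Q} (hV : V.support ⊆ S)
    (h : (V.restrict S).IsRigid) : V.IsRigid := by
  rw [isRigid_iff] at h ⊢
  have hV' : ∀ i ∉ S, Subsingleton (V.space i) := fun i hi =>
    subsingleton_of_notMem_support fun h => hi (hV h)
  intro g
  obtain ⟨f, hf⟩ : ∃ f : ∀ i, i ∈ S → (V.space i →ₗ[k] V.space i), ∀ (i j : Q) (α : i ⟶ j)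
      (hi : i ∈ S) (hj : j ∈ S) (x : V.space i),
      f j hj (V.map α x) - V.map α (f i hi x) = g i j α x := by
    obtain ⟨f, hf⟩ := h fun i j α => g i j α
    exact ⟨fun i h => f ⟨i, h⟩, fun i j α hi hj x =>
      LinearMap.congr_fun (congrFun (congrFun (congrFun hf ⟨i, hi⟩) ⟨j, hj⟩) α) x⟩
  refine ⟨fun i => if h : i ∈ S then f i h else 0, ?_⟩
  funext i j α
  ext x
  by_cases hi : i ∈ S
  · by_cases hj : j ∈ S
    · rw [extMap_apply, dif_pos hi, dif_pos hj]
      exact hf i j α hi hj x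
    · exact (hV' j hj).elim _ _
  · rw [(hV' i hi).elim x 0]
    simp

/-- A support may have gaps, which is why linear quivers are described by positions in `ℕ` that need
not be consecutive. -/
theorem IsLinear.subtype {pos : Q → ℕ} {dir : ℕ → Bool} (hQ : IsLinear Q pos dir) (S : Set Q) :
    IsLinear S (fun i => pos i) dir where
  inj := hQ.inj.comp Subtype.val_injective
  arrow {i j} α := hQ.arrow (i := i) (j := j) α
  subsing i j := hQ.subsing i j
  exists_arrow i j h := hQ.exists_arrow i j h

end Restrict

end QuiverRep

/-! ### Type A as a linear quiver. -/

namespace TypeA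

variable {n : ℕ} {o : Fin (n - 1) → Bool}

/-- The direction of the edge between the positions `e` and `e + 1`. -/
def dir (o : Fin (n - 1) → Bool) (e : ℕ) : Bool := if h : e < n - 1 then o ⟨e, h⟩ else true

theorem pos_lt (i : TypeA n o) : i.pos < n := Fin.is_lt (n := n) i

theorem isLinear : QuiverRep.IsLinear (TypeA n o) TypeA.pos (dir o) where
  inj := Fin.val_injective (n := n)
  arrow {i j} α := by
    obtain ⟨e, ⟨h1, h2, h3⟩ | ⟨h1, h2, h3⟩⟩ := α
    · left
      simp only [dir, h2, e.2, dif_pos]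
      exact ⟨h1, h3⟩
    · right
      simp only [dir, h3, e.2, dif_pos]
      exact ⟨h1, h2⟩
  subsing i j := by
    refine ⟨fun α β => ?_⟩
    obtain ⟨e, he⟩ := α
    obtain ⟨f, hf⟩ := β
    congr 1
    ext
    omega
  exists_arrow i j h := by
    have hlt : i.pos < n - 1 := by
      have := pos_lt j
      omega
    constructor <;> intro hd <;> rw [dir, dif_pos hlt] at hd
    · exact ⟨⟨⟨i.pos, hlt⟩, Or.inl ⟨hd, rfl, h⟩⟩⟩
    · exact ⟨⟨⟨i.pos, hlt⟩, Or.inr ⟨hd, h, rfl⟩⟩⟩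

theorem isOccupied_iff {p : ℕ × ℕ} :
    QuiverRep.IsOccupied (TypeA.pos (n := n) (o := o)) p ↔ p.1 ≤ p.2 ∧ p.2 < n := by
  constructor
  · rintro ⟨h1, h2⟩
    obtain ⟨i, hi⟩ := h2 p.2 h1 le_rfl
    exact ⟨h1, hi ▸ pos_lt i⟩
  · rintro ⟨h1, h2⟩
    exact ⟨h1, fun q _ hq => ⟨(⟨q, by omega⟩ : Fin n), rfl⟩⟩

theorem exists_pos_eq {p : ℕ} (hp : p < n) : ∃ i : TypeA n o, i.pos = p :=
  ⟨(⟨p, hp⟩ : Fin n), rfl⟩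

theorem card_eq : Fintype.card (TypeA n o) = n := Fintype.card_fin n

end TypeA

namespace QuiverRep

/-! ### Uniqueness of nonnegative combinations of compatible intervals. -/

section Combinatorics

variable {k : Type u} [Field k] {dir : ℕ → Bool}

/-- The intervals are disjoint, so no morphism contributes at the edge joining them, and the arrow
there gives a nonsplit extension in one of the two orders. -/
theorem not_extVanishes_adjacent {a m d : ℕ} (ham : a ≤ m) (hmd : m + 1 ≤ d)
    (h : ExtVanishes k dir (a, m) (m + 1, d)) (h' : ExtVanishes k dir (m + 1, d) (a, m)) :
    False := by
  have h1 : m ∈ Set.Icc a m := ⟨ham, le_rfl⟩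
  have h2 : m + 1 ∈ Set.Icc (m + 1) d := ⟨le_rfl, hmd⟩
  have h3 : m ∉ Set.Icc (m + 1) d := fun h => by have := h.1; omega
  have h4 : m + 1 ∉ Set.Icc a m := fun h => by have := h.2; omega
  cases hd : dir m with
  | true =>
    obtain ⟨F, hF⟩ := h fun _ => 1
    have := (hF m).1 hd h1 h2
    rw [Set.indicator_of_notMem h3, Set.indicator_of_notMem h4, sub_zero] at this
    exact zero_ne_one this
  | false =>
    obtain ⟨F, hF⟩ := h' fun _ => 1
    have := (hF m).2 hd h2 h1
    rw [Set.indicator_of_notMem h3, Set.indicator_of_notMem h4, sub_zero] at this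
    exact zero_ne_one this

/-- On the common part `[c + 1, m]` a morphism is a single scalar. The edges `c` and `m` bounding it
each impose an equation on this scalar (`hL`, `hR`): one unknown cannot meet two independent
conditions. -/
theorem not_extVanishes_of_boundary {p q : ℕ × ℕ} {c m : ℕ} (hcm : c + 1 ≤ m)
    (hp1 : p.1 ≤ c + 1) (hq1 : q.1 ≤ c + 1) (hp2 : m ≤ p.2) (hq2 : m ≤ q.2)
    (hL : (dir c = true ∧ p.1 ≤ c ∧ c < q.1) ∨ (dir c = false ∧ q.1 ≤ c ∧ c < p.1))
    (hR : (dir m = true ∧ p.2 < m + 1 ∧ m + 1 ≤ q.2) ∨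
      (dir m = false ∧ q.2 < m + 1 ∧ m + 1 ≤ p.2))
    (h : ExtVanishes k dir p q) : False := by
  classical
  -- With right-hand side concentrated on the left edge, interior edges make `F` constant, the right
  -- edge makes it zero, and the left edge would require a nonzero value.
  obtain ⟨F, hF⟩ := h (Pi.single c 1)
  have hmemp : ∀ e, c + 1 ≤ e → e ≤ m → e ∈ Set.Icc p.1 p.2 := fun e h1 h2 =>
    ⟨hp1.trans h1, h2.trans hp2⟩
  have hmemq : ∀ e, c + 1 ≤ e → e ≤ m → e ∈ Set.Icc q.1 q.2 := fun e h1 h2 =>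
    ⟨hq1.trans h1, h2.trans hq2⟩
  have hconst : ∀ e, c + 1 ≤ e → e ≤ m → F e = F (c + 1) := by
    intro e he
    induction e, he using Nat.le_induction with
    | base => exact fun _ => rfl
    | succ e he ih =>
      intro hem
      rw [← ih (by omega)]
      have h1 := hmemp e he (by omega)
      have h2 := hmemq e he (by omega)
      have h3 := hmemp (e + 1) (by omega) hem
      have h4 := hmemq (e + 1) (by omega) hem
      have hne : e ≠ c := by omega
      cases hd : dir e with
      | true =>
        have := (hF e).1 hd h1 h4
        rw [Set.indicator_of_mem h3, Set.indicator_of_mem h2, Pi.single_eq_of_ne hne] at this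
        exact sub_eq_zero.1 this
      | false =>
        have := (hF e).2 hd h3 h2
        rw [Set.indicator_of_mem h1, Set.indicator_of_mem h4, Pi.single_eq_of_ne hne] at this
        exact (sub_eq_zero.1 this).symm
  have hm0 : F m = 0 := by
    have h1 := hmemp m hcm le_rfl
    have h2 := hmemq m hcm le_rfl
    have hne : m ≠ c := by omega
    rcases hR with ⟨hd, h3, h4⟩ | ⟨hd, h3, h4⟩
    · have := (hF m).1 hd h1 ⟨by omega, h4⟩
      rw [Set.indicator_of_notMem (fun h => by have := h.2; omega), Set.indicator_of_mem h2,
        Pi.single_eq_of_ne hne, zero_sub] at this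
      exact neg_eq_zero.1 this
    · have := (hF m).2 hd ⟨by omega, h4⟩ h2
      rwa [Set.indicator_of_mem h1, Set.indicator_of_notMem (fun h => by have := h.2; omega),
        Pi.single_eq_of_ne hne, sub_zero] at this
  have hc0 : F (c + 1) = 0 := by rw [← hconst m hcm le_rfl, hm0]
  have h1 := hmemp (c + 1) le_rfl hcm
  have h2 := hmemq (c + 1) le_rfl hcm
  rcases hL with ⟨hd, h3, h4⟩ | ⟨hd, h3, h4⟩
  · have := (hF c).1 hd ⟨h3, by omega⟩ h2
    rw [Set.indicator_of_mem h1, Set.indicator_of_notMem (fun h => by have := h.1; omega),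
      Pi.single_eq_same, hc0, sub_zero] at this
    exact zero_ne_one this
  · have := (hF c).2 hd h1 ⟨h3, by omega⟩
    rw [Set.indicator_of_mem h2, Set.indicator_of_notMem (fun h => by have := h.1; omega),
      Pi.single_eq_same, hc0, sub_zero] at this
    exact zero_ne_one this

/-- Both pairs overlap in `[c, m]`. If the two edges bounding it point the same way, the crossing
pair `[a, m]`, `[c, d']` has an extension; if they point in opposite ways, the nested pair `[a, d]`,
`[c, m]` has one. -/
theorem not_extVanishes_nested_crossing {a c m d d' : ℕ} (hac : a < c) (hcm : c ≤ m)
    (hd : m < d) (hd' : m < d') (h1 : ExtVanishes k dir (a, d) (c, m))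
    (h2 : ExtVanishes k dir (c, m) (a, d)) (h3 : ExtVanishes k dir (c, d') (a, m))
    (h4 : ExtVanishes k dir (a, m) (c, d')) : False := by
  obtain ⟨c, rfl⟩ : ∃ c', c = c' + 1 := ⟨c - 1, by omega⟩
  have hb : ∀ b : Bool, b = true ∨ b = false := by decide
  rcases hb (dir c) with hc | hc <;> rcases hb (dir m) with hm | hm
  · exact not_extVanishes_of_boundary (c := c) (m := m) hcm (by dsimp only; omega)
      (by dsimp only; omega) (by dsimp only; omega) (by dsimp only; omega)
      (Or.inl ⟨hc, by dsimp only; omega, by dsimp only; omega⟩)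
      (Or.inl ⟨hm, by dsimp only; omega, by dsimp only; omega⟩) h4
  · exact not_extVanishes_of_boundary (c := c) (m := m) hcm (by dsimp only; omega)
      (by dsimp only; omega) (by dsimp only; omega) (by dsimp only; omega)
      (Or.inl ⟨hc, by dsimp only; omega, by dsimp only; omega⟩)
      (Or.inr ⟨hm, by dsimp only; omega, by dsimp only; omega⟩) h1
  · exact not_extVanishes_of_boundary (c := c) (m := m) hcm (by dsimp only; omega)
      (by dsimp only; omega) (by dsimp only; omega) (by dsimp only; omega)
      (Or.inr ⟨hc, by dsimp only; omega, by dsimp only; omega⟩)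
      (Or.inl ⟨hm, by dsimp only; omega, by dsimp only; omega⟩) h2
  · exact not_extVanishes_of_boundary (c := c) (m := m) hcm (by dsimp only; omega)
      (by dsimp only; omega) (by dsimp only; omega) (by dsimp only; omega)
      (Or.inr ⟨hc, by dsimp only; omega, by dsimp only; omega⟩)
      (Or.inr ⟨hm, by dsimp only; omega, by dsimp only; omega⟩) h3

theorem exists_lt_of_sum_eq {ι : Type*} {s : Finset ι} {f g : ι → ℝ}
    (h : ∑ i ∈ s, f i = ∑ i ∈ s, g i) {i : ι} (hi : i ∈ s) (hne : f i ≠ g i) :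
    ∃ j ∈ s, g j < f j := by
  by_contra! hle
  exact hne ((Finset.sum_eq_sum_iff_of_le hle).1 h i hi)

/-- Nonnegative weights on intervals of `[0, n)` with pairwise vanishing extensions. -/
structure IsCompatibleWeight (k : Type u) [Field k] (dir : ℕ → Bool) (n : ℕ) (w : ℕ × ℕ → ℝ) :
    Prop where
  nonneg : ∀ q, 0 ≤ w q
  valid : ∀ q, w q ≠ 0 → q.1 ≤ q.2 ∧ q.2 < n
  compat : ∀ p q, w p ≠ 0 → w q ≠ 0 → ExtVanishes k dir p q

variable {n : ℕ} {w v : ℕ × ℕ → ℝ}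

/-- Total weight of the intervals starting at `a` and containing `[a, m]`. -/
def tailWeight (n : ℕ) (w : ℕ × ℕ → ℝ) (m a : ℕ) : ℝ := ∑ b ∈ Finset.Ico m n, w (a, b)

theorem tailWeight_eq {m : ℕ} (hm : m < n) (a : ℕ) :
    tailWeight n w m a = w (a, m) + tailWeight n w (m + 1) a :=
  Finset.sum_eq_sum_Ico_succ_bot hm _

theorem IsCompatibleWeight.exists_of_lt
    (hv : IsCompatibleWeight k dir n v) {m a : ℕ} (h : tailWeight n v m a < tailWeight n w m a) :
    ∃ d, m ≤ d ∧ w (a, d) ≠ 0 := by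
  by_contra! h0
  have h1 : tailWeight n w m a = 0 :=
    Finset.sum_eq_zero fun b hb => h0 b (Finset.mem_Ico.1 hb).1
  have h2 : 0 ≤ tailWeight n v m a := Finset.sum_nonneg fun b _ => hv.nonneg _
  linarith

/-- When the tails agree at `m` but that of `w` is smaller at `m + 1`, the missing weight sits on
the interval ending exactly at `m`. -/
theorem IsCompatibleWeight.ne_zero_of_lt (hv : IsCompatibleWeight k dir n v) {m a : ℕ}
    (hm : m < n) (he : tailWeight n w m a = tailWeight n v m a)
    (h : tailWeight n w (m + 1) a < tailWeight n v (m + 1) a) : w (a, m) ≠ 0 := by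
  rw [tailWeight_eq hm, tailWeight_eq hm] at he
  have := hv.nonneg (a, m)
  intro h0
  linarith

/-- Induction along the positions. If the tails first differ at `m + 1`, equality of the sums gives
starting points `a` and `c` where `w`, respectively `v`, has the larger tail. Then `w` uses some
`[a, d]` and `v` some `[c, d']` reaching beyond `m`. Agreement at `m` forces `w` to use `[c, m]` if
`c ≤ m`, and `v` to use `[a, m]` if `a ≤ m`. A start at `m + 1` produces adjacent intervals;
otherwise one weight contains a nested and the other a crossing pair. -/
theorem IsCompatibleWeight.tailWeight_unique (hw : IsCompatibleWeight k dir n w)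
    (hv : IsCompatibleWeight k dir n v)
    (h : ∀ p < n, ∑ a ∈ Finset.range (p + 1), tailWeight n w p a =
      ∑ a ∈ Finset.range (p + 1), tailWeight n v p a) (m : ℕ) :
    m < n → ∀ a ≤ m, tailWeight n w m a = tailWeight n v m a := by
  induction m with
  | zero =>
    intro hn a ha
    obtain rfl : a = 0 := by omega
    simpa using h 0 hn
  | succ m ih =>
    intro hn a₀ ha₀
    by_contra hne
    have hs := h (m + 1) hn
    have ha₀' : a₀ ∈ Finset.range (m + 1 + 1) := Finset.mem_range.2 (by omega)
    obtain ⟨a, ha, hlt⟩ := exists_lt_of_sum_eq hs ha₀' hne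
    obtain ⟨c, hc, hlt'⟩ := exists_lt_of_sum_eq hs.symm ha₀' (Ne.symm hne)
    rw [Finset.mem_range] at ha hc
    have hne' : a ≠ c := by
      rintro rfl
      exact lt_asymm hlt hlt'
    obtain ⟨d, hd, hwa⟩ := hv.exists_of_lt hlt
    obtain ⟨d', hd', hvc⟩ := hw.exists_of_lt hlt'
    have hwc : c ≤ m → w (c, m) ≠ 0 := fun hcm =>
      hv.ne_zero_of_lt (by omega) (ih (by omega) c hcm) hlt'
    have hva : a ≤ m → v (a, m) ≠ 0 := fun ham =>
      hw.ne_zero_of_lt (by omega) (ih (by omega) a ham).symm hlt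
    rcases Nat.lt_or_ge m a with h1 | h1
    · obtain rfl : a = m + 1 := by omega
      have h2 := hwc (by omega)
      exact not_extVanishes_adjacent (by omega) hd (hw.compat _ _ h2 hwa) (hw.compat _ _ hwa h2)
    rcases Nat.lt_or_ge m c with h2 | h2
    · obtain rfl : c = m + 1 := by omega
      have h3 := hva h1
      exact not_extVanishes_adjacent h1 hd' (hv.compat _ _ h3 hvc) (hv.compat _ _ hvc h3)
    have h3 := hwc h2
    have h4 := hva h1
    rcases lt_or_gt_of_ne hne' with hac | hac
    · exact not_extVanishes_nested_crossing hac h2 hd hd' (hw.compat _ _ hwa h3)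
        (hw.compat _ _ h3 hwa) (hv.compat _ _ hvc h4) (hv.compat _ _ h4 hvc)
    · exact not_extVanishes_nested_crossing hac h1 hd' hd (hv.compat _ _ hvc h4)
        (hv.compat _ _ h4 hvc) (hw.compat _ _ hwa h3) (hw.compat _ _ h3 hwa)

theorem IsCompatibleWeight.unique (hw : IsCompatibleWeight k dir n w)
    (hv : IsCompatibleWeight k dir n v)
    (h : ∀ p < n, ∑ a ∈ Finset.range (p + 1), tailWeight n w p a =
      ∑ a ∈ Finset.range (p + 1), tailWeight n v p a) : w = v := by
  have key := hw.tailWeight_unique hv h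
  funext ⟨a, b⟩
  by_cases hab : a ≤ b ∧ b < n
  · have h1 := key b hab.2 a hab.1
    rw [tailWeight_eq hab.2, tailWeight_eq hab.2] at h1
    -- The weight of `(a, b)` is the difference of consecutive tails; beyond the last position the
    -- tail is empty.
    rcases Nat.lt_or_ge (b + 1) n with h2 | h2
    · have h3 := key (b + 1) h2 a (by omega)
      linarith
    · have h3 : ∀ w, tailWeight n w (b + 1) a = 0 := fun w => by
        rw [tailWeight, Finset.Ico_eq_empty_of_le h2, Finset.sum_empty]
      rw [h3, h3] at h1
      linarith
  · rw [not_not.1 fun h => hab (hw.valid (a, b) h), not_not.1 fun h => hab (hv.valid (a, b) h)]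

/-- The characteristic function of an interval of positions. -/
def intervalVec (q : ℕ × ℕ) (p : ℕ) : ℝ := if q.1 ≤ p ∧ p ≤ q.2 then 1 else 0

theorem intervalVec_nonneg (q : ℕ × ℕ) (p : ℕ) : 0 ≤ intervalVec q p := by
  unfold intervalVec
  split_ifs <;> norm_num

theorem sum_mul_intervalVec {F : Finset (ℕ × ℕ)} (hF : ∀ q ∈ F, q.1 ≤ q.2 ∧ q.2 < n)
    (hw : ∀ q, w q ≠ 0 → q ∈ F) (p : ℕ) :
    ∑ q ∈ F, w q * intervalVec q p = ∑ a ∈ Finset.range (p + 1), tailWeight n w p a := by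
  classical
  unfold tailWeight
  rw [← Finset.sum_product (Finset.range (p + 1)) (Finset.Ico p n) w]
  have : ∀ q ∈ F, w q * intervalVec q p = if q.1 ≤ p ∧ p ≤ q.2 then w q else 0 := fun q _ => by
    unfold intervalVec
    split_ifs <;> simp
  rw [Finset.sum_congr rfl this, ← Finset.sum_filter]
  refine Finset.sum_subset (fun q hq => ?_) (fun q hq hq' => ?_)
  · rw [Finset.mem_filter] at hq
    have := hF q hq.1
    simp only [Finset.mem_product, Finset.mem_range, Finset.mem_Ico]
    omega
  · by_contra h0
    refine hq' (Finset.mem_filter.2 ⟨hw q h0, ?_⟩)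
    simp only [Finset.mem_product, Finset.mem_range, Finset.mem_Ico] at hq
    omega

/-- A collection of sets of intervals in which nonnegative combinations are unique. -/
def HasUniqueCombinations (n : ℕ) (𝒟 : Set (Finset (ℕ × ℕ))) : Prop :=
  ∀ F ∈ 𝒟, ∀ G ∈ 𝒟, ∀ w v : ℕ × ℕ → ℝ, (∀ q, 0 ≤ w q) → (∀ q, 0 ≤ v q) →
    (∀ q, w q ≠ 0 → q ∈ F) → (∀ q, v q ≠ 0 → q ∈ G) →
    (∀ p < n, ∑ q ∈ F, w q * intervalVec q p = ∑ q ∈ G, v q * intervalVec q p) → w = v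

/-- The sets of intervals in `[0, n)` with pairwise vanishing extensions. -/
def compatibleSets (k : Type u) [Field k] (dir : ℕ → Bool) (n : ℕ) : Set (Finset (ℕ × ℕ)) :=
  {F | (∀ q ∈ F, q.1 ≤ q.2 ∧ q.2 < n) ∧ ∀ p ∈ F, ∀ q ∈ F, ExtVanishes k dir p q}

theorem hasUniqueCombinations_compatibleSets (k : Type u) [Field k] (dir : ℕ → Bool) (n : ℕ) :
    HasUniqueCombinations n (compatibleSets k dir n) := by
  intro F hF G hG w v hw0 hv0 hw hv h
  refine IsCompatibleWeight.unique (k := k) (dir := dir) (n := n)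
    ⟨hw0, fun q hq => hF.1 q (hw q hq), fun p q hp hq => hF.2 p (hw p hp) q (hw q hq)⟩
    ⟨hv0, fun q hq => hG.1 q (hv q hq), fun p q hp hq => hG.2 p (hv p hp) q (hv q hq)⟩
    fun p hp => ?_
  rw [← sum_mul_intervalVec hF.1 hw, ← sum_mul_intervalVec hG.1 hv, h p hp]

/-- The sets of one-element intervals in `[0, n)`. -/
def singletonSets (n : ℕ) : Set (Finset (ℕ × ℕ)) := {F | ∀ q ∈ F, q.1 = q.2 ∧ q.2 < n}

theorem sum_mul_intervalVec_singleton {F : Finset (ℕ × ℕ)} (hF : F ∈ singletonSets n)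
    (hw : ∀ q, w q ≠ 0 → q ∈ F) (p : ℕ) :
    ∑ q ∈ F, w q * intervalVec q p = w (p, p) := by
  rw [Finset.sum_eq_single (p, p)]
  · simp [intervalVec]
  · rintro ⟨a, b⟩ hq hne
    obtain rfl : a = b := (hF _ hq).1
    rw [intervalVec, if_neg, mul_zero]
    rintro ⟨h1, h2⟩
    obtain rfl : a = p := le_antisymm h1 h2
    exact hne rfl
  · intro h
    rw [not_not.1 (mt (hw _) h), zero_mul]

theorem hasUniqueCombinations_singletonSets (n : ℕ) :
    HasUniqueCombinations n (singletonSets n) := by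
  intro F hF G hG w v _ _ hw hv h
  funext ⟨a, b⟩
  by_cases hab : a = b ∧ b < n
  · obtain ⟨rfl, hb⟩ := hab
    have := h a hb
    rwa [sum_mul_intervalVec_singleton hF hw, sum_mul_intervalVec_singleton hG hv] at this
  · rw [not_not.1 fun h => hab (hF _ (hw (a, b) h)), not_not.1 fun h => hab (hG _ (hv (a, b) h))]

end Combinatorics

end QuiverRep

/-! ### Volume of unimodular simplices. -/

section Simplex

theorem convexHull_zero_union_range {ι E : Type*} [Fintype ι] [AddCommGroup E] [Module ℝ E]
    (v : ι → E) : convexHull ℝ ({0} ∪ Set.range v) =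
      {x | ∃ w : ι → ℝ, (∀ i, 0 ≤ w i) ∧ ∑ i, w i ≤ 1 ∧ ∑ i, w i • v i = x} := by
  classical
  apply Set.Subset.antisymm
  · refine convexHull_min ?_ ?_
    · rintro x (rfl | ⟨i, rfl⟩)
      · exact ⟨0, fun i => le_rfl, by simp, by simp⟩
      · refine ⟨Pi.single i 1, fun j => ?_, ?_, ?_⟩
        · by_cases h : j = i
          · subst h; simp
          · simp [h]
        · simp
        · simp [Pi.single_apply]
    · rintro x ⟨w, hw, hw1, rfl⟩ y ⟨w', hw', hw1', rfl⟩ a b ha hb hab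
      refine ⟨fun i => a * w i + b * w' i, fun i => ?_, ?_, ?_⟩
      · have := hw i
        have := hw' i
        positivity
      · rw [Finset.sum_add_distrib, ← Finset.mul_sum, ← Finset.mul_sum]
        nlinarith
      · simp only [add_smul, Finset.sum_add_distrib, Finset.smul_sum, mul_smul]
  · rintro x ⟨w, hw, hw1, rfl⟩
    -- The vertex `0`, indexed by `none`, takes up the slack `1 - ∑ w`.
    have h := (convex_convexHull ℝ ({0} ∪ Set.range v)).sum_mem (t := Finset.univ)
      (w := fun o : Option ι => o.elim (1 - ∑ i, w i) w) (z := fun o => o.elim 0 v) ?_ ?_ ?_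
    · simpa [Fintype.sum_option] using h
    · rintro (_ | i) _
      · simpa using hw1
      · exact hw i
    · simp [Fintype.sum_option]
    · rintro (_ | i) _
      · exact subset_convexHull ℝ _ (Or.inl rfl)
      · exact subset_convexHull ℝ _ (Or.inr ⟨i, rfl⟩)

/-- The corner of the positive orthant cut off by the hyperplane `∑ x = r`. -/
def orthantCorner (ι : Type*) [Fintype ι] (r : ℝ) : Set (ι → ℝ) :=
  {x | (∀ i, 0 ≤ x i) ∧ ∑ i, x i ≤ r}

theorem isClosed_orthantCorner (ι : Type*) [Fintype ι] (r : ℝ) :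
    IsClosed (orthantCorner ι r) := by
  have : orthantCorner ι r = (⋂ i, {x : ι → ℝ | 0 ≤ x i}) ∩ {x | ∑ i, x i ≤ r} := by
    ext x
    simp [orthantCorner]
  rw [this]
  refine (isClosed_iInter fun i => isClosed_le continuous_const (continuous_apply i)).inter ?_
  exact isClosed_le (continuous_finsetSum _ fun i _ => continuous_apply i) continuous_const

/-- Slicing by the first coordinate `t` leaves a corner of size `r - t`, hence the general `r`; the
factor `1 / n!` arises by integrating `(r - t) ^ n`. -/
theorem volume_orthantCorner_fin (n : ℕ) : ∀ r : ℝ, 0 ≤ r →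
    volume (orthantCorner (Fin n) r) = ENNReal.ofReal (r ^ n / n !) := by
  induction n with
  | zero =>
    intro r hr
    have : orthantCorner (Fin 0) r = Set.univ := by
      ext x
      simp [orthantCorner, hr]
    rw [this]
    simp [volume_pi]
  | succ n ih =>
    intro r hr
    let S : Set (ℝ × (Fin n → ℝ)) := {y | 0 ≤ y.1 ∧ y.2 ∈ orthantCorner (Fin n) (r - y.1)}
    have hS : orthantCorner (Fin (n + 1)) r =
        (MeasurableEquiv.piFinSuccAbove (fun _ => ℝ) 0) ⁻¹' S := by
      ext x
      simp only [orthantCorner, S, Set.mem_preimage, Set.mem_ofPred_eq, Fin.forall_fin_succ,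
        Fin.sum_univ_succ, MeasurableEquiv.piFinSuccAbove_apply]
      simp only [Fin.insertNthEquiv, Equiv.coe_fn_symm_mk, Fin.removeNth, Fin.succAbove_zero,
        and_assoc, le_sub_iff_add_le']
    have hSm : MeasurableSet S := by
      have : S = (MeasurableEquiv.piFinSuccAbove (fun _ => ℝ) 0).symm ⁻¹'
          orthantCorner (Fin (n + 1)) r := by
        rw [hS]
        ext y
        simp
      rw [this]
      exact (MeasurableEquiv.measurable _) (isClosed_orthantCorner _ _).measurableSet
    rw [hS, (volume_preserving_piFinSuccAbove (fun _ => ℝ) 0).measure_preimage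
      hSm.nullMeasurableSet, Measure.volume_eq_prod, Measure.prod_apply hSm]
    have hslice : ∀ t : ℝ, volume (Prod.mk t ⁻¹' S) =
        (Set.Icc 0 r).indicator (fun t => ENNReal.ofReal ((r - t) ^ n / n !)) t := by
      intro t
      by_cases ht : t ∈ Set.Icc 0 r
      · rw [Set.indicator_of_mem ht, ← ih (r - t) (by linarith [ht.2])]
        congr 1
        ext y
        simp [S, ht.1]
      · rw [Set.indicator_of_notMem ht]
        have : Prod.mk t ⁻¹' S = ∅ := by
          ext y
          simp only [Set.mem_preimage, S, Set.mem_ofPred_eq, Set.mem_empty_iff_false, iff_false]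
          rintro ⟨h0, h1, h2⟩
          have := Finset.sum_nonneg fun i (_ : i ∈ Finset.univ) => h1 i
          exact ht ⟨h0, by linarith⟩
        rw [this, measure_empty]
    simp_rw [hslice]
    rw [lintegral_indicator measurableSet_Icc, ← ofReal_integral_eq_lintegral_ofReal]
    · congr 1
      rw [integral_Icc_eq_integral_Ioc, ← intervalIntegral.integral_of_le hr,
        intervalIntegral.integral_div, intervalIntegral.integral_comp_sub_left (fun x => x ^ n) r,
        integral_pow, Nat.factorial_succ]
      push_cast
      have : (n ! : ℝ) ≠ 0 := by positivity
      field_simp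
      simp
    · exact (Continuous.integrableOn_Icc (by fun_prop))
    · filter_upwards [ae_restrict_mem measurableSet_Icc] with t ht
      have : 0 ≤ r - t := by linarith [ht.2]
      simp only [Pi.zero_apply]
      positivity

theorem volume_orthantCorner (ι : Type*) [Fintype ι] :
    volume (orthantCorner ι 1) = ENNReal.ofReal (1 / (Fintype.card ι)!) := by
  let e := Fintype.equivFin ι
  have h := volume_measurePreserving_piCongrLeft (fun _ : Fin (Fintype.card ι) => ℝ) e
  have hS : orthantCorner ι 1 = (MeasurableEquiv.piCongrLeft (fun _ => ℝ) e) ⁻¹'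
      orthantCorner (Fin (Fintype.card ι)) 1 := by
    ext x
    have hx : ∀ j, (MeasurableEquiv.piCongrLeft (fun _ => ℝ) e) x j = x (e.symm j) := fun j => by
      obtain ⟨i, rfl⟩ := e.surjective j
      rw [MeasurableEquiv.coe_piCongrLeft, Equiv.piCongrLeft_apply_apply, Equiv.symm_apply_apply]
    simp only [orthantCorner, Set.mem_preimage, Set.mem_ofPred_eq, hx]
    rw [Equiv.sum_comp e.symm x]
    refine and_congr_left fun _ => ⟨fun h j => h _, fun h i => ?_⟩
    simpa using h (e i)
  rw [hS, h.measure_preimage (isClosed_orthantCorner _ _).measurableSet.nullMeasurableSet,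
    volume_orthantCorner_fin _ _ zero_le_one, one_pow]

theorem convexHull_zero_union_single (ι : Type*) [Fintype ι] [DecidableEq ι] :
    convexHull ℝ ({0} ∪ Set.range fun i : ι => (Pi.single i 1 : ι → ℝ)) = orthantCorner ι 1 := by
  rw [convexHull_zero_union_range]
  ext x
  have hsum : ∀ w : ι → ℝ, ∑ i, w i • (Pi.single i 1 : ι → ℝ) = w := fun w => by
    ext j
    simp [Finset.sum_apply, Pi.single_apply]
  constructor
  · rintro ⟨w, h1, h2, rfl⟩
    rw [hsum]
    exact ⟨h1, h2⟩
  · rintro ⟨h1, h2⟩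
    exact ⟨x, h1, h2, hsum x⟩

/-- The simplex is the image of the standard corner under a matrix with determinant `±1`. -/
theorem IsUnimodularSimplex.integralVolume_eq_one {Q : Type v} [Fintype Q] {S : Set (Q → ℝ)}
    (hS : IsUnimodularSimplex S) : integralVolume S = 1 := by
  classical
  obtain ⟨b, rfl⟩ := hS
  let B : Matrix Q Q ℤ := (Pi.basisFun ℤ Q).toMatrix b
  have hB : IsUnit B.det := (Pi.basisFun ℤ Q).isUnit_det b
  let L : (Q → ℝ) →ₗ[ℝ] (Q → ℝ) := Matrix.toLin' (B.map (Int.castRingHom ℝ))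
  have hL : |LinearMap.det L| = 1 := by
    rw [LinearMap.det_toLin', ← RingHom.mapMatrix_apply, ← RingHom.map_det]
    rcases Int.isUnit_iff.1 hB with h | h <;> simp [h]
  have himg : convexHull ℝ ({0} ∪ Set.range fun x => fun i => ((b x i : ℤ) : ℝ)) =
      L '' orthantCorner Q 1 := by
    rw [← convexHull_zero_union_single, LinearMap.image_convexHull, Set.image_union,
      Set.image_singleton, map_zero, ← Set.range_comp]
    congr 3
    funext x i
    simp [L, B, Module.Basis.toMatrix_apply]
  rw [himg, integralVolume, Measure.addHaar_image_linearMap, hL, volume_orthantCorner]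
  have : ((Fintype.card Q)! : ℝ≥0∞) = ENNReal.ofReal ((Fintype.card Q)! : ℝ) := by simp
  rw [this, ENNReal.ofReal_one, one_mul, ← ENNReal.ofReal_mul (by positivity)]
  have : ((Fintype.card Q)! : ℝ) ≠ 0 := by positivity
  rw [mul_one_div_cancel this, ENNReal.ofReal_one]

end Simplex

namespace QuiverRep

/-! ### Signed simplices, unimodularity and the counting principle. -/

section Fan

/-- A pair of sets of intervals of `[0, n)` generating a unimodular simplex: the members of `F`
enter positively, those of `G` negatively. -/
structure IsFanPair (n : ℕ) (𝒟 ℰ : Set (Finset (ℕ × ℕ))) (F G : Finset (ℕ × ℕ)) : Prop where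
  left_mem : F ∈ 𝒟
  right_mem : G ∈ ℰ
  card : F.card + G.card = n
  left_valid : ∀ q ∈ F, q.1 ≤ q.2 ∧ q.2 < n
  right_valid : ∀ q ∈ G, q.1 ≤ q.2 ∧ q.2 < n
  disjoint : ∀ q ∈ F, ∀ r ∈ G, ∀ p, intervalVec q p * intervalVec r p = 0

variable {n : ℕ} {𝒟 ℰ : Set (Finset (ℕ × ℕ))} {F G F' G' : Finset (ℕ × ℕ)}

/-- At each position the positive or the negative contribution vanishes. Both being nonnegative,
their difference determines each of them, and uniqueness applies to the two sides separately. -/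
theorem IsFanPair.unique (h𝒟 : HasUniqueCombinations n 𝒟) (hℰ : HasUniqueCombinations n ℰ)
    (h : IsFanPair n 𝒟 ℰ F G) (h' : IsFanPair n 𝒟 ℰ F' G') {w u w' u' : ℕ × ℕ → ℝ}
    (hw0 : ∀ q, 0 ≤ w q) (hu0 : ∀ q, 0 ≤ u q) (hw0' : ∀ q, 0 ≤ w' q) (hu0' : ∀ q, 0 ≤ u' q)
    (hw : ∀ q, w q ≠ 0 → q ∈ F) (hu : ∀ q, u q ≠ 0 → q ∈ G)
    (hw' : ∀ q, w' q ≠ 0 → q ∈ F') (hu' : ∀ q, u' q ≠ 0 → q ∈ G')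
    (heq : ∀ p < n, ∑ q ∈ F, w q * intervalVec q p - ∑ q ∈ G, u q * intervalVec q p =
      ∑ q ∈ F', w' q * intervalVec q p - ∑ q ∈ G', u' q * intervalVec q p) :
    w = w' ∧ u = u' := by
  have hnn : ∀ (w : ℕ × ℕ → ℝ), (∀ q, 0 ≤ w q) → ∀ (F : Finset (ℕ × ℕ)) p,
      0 ≤ ∑ q ∈ F, w q * intervalVec q p := fun w hw F p =>
    Finset.sum_nonneg fun q _ => mul_nonneg (hw q) (intervalVec_nonneg q p)
  have hdis : ∀ (w u : ℕ × ℕ → ℝ) (F G : Finset (ℕ × ℕ)), IsFanPair n 𝒟 ℰ F G → ∀ p,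
      (∑ q ∈ F, w q * intervalVec q p) * (∑ q ∈ G, u q * intervalVec q p) = 0 := by
    intro w u F G h p
    rw [Finset.sum_mul_sum]
    refine Finset.sum_eq_zero fun q hq => Finset.sum_eq_zero fun r hr => ?_
    rw [mul_mul_mul_comm, h.disjoint q hq r hr p, mul_zero]
  have key : ∀ p < n, ∑ q ∈ F, w q * intervalVec q p = ∑ q ∈ F', w' q * intervalVec q p ∧
      ∑ q ∈ G, u q * intervalVec q p = ∑ q ∈ G', u' q * intervalVec q p := by
    intro p hp
    have h1 := heq p hp
    have h2 := hnn w hw0 F p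
    have h3 := hnn u hu0 G p
    have h4 := hnn w' hw0' F' p
    have h5 := hnn u' hu0' G' p
    rcases mul_eq_zero.1 (hdis w u F G h p) with h6 | h6 <;>
      rcases mul_eq_zero.1 (hdis w' u' F' G' h' p) with h7 | h7 <;>
      constructor <;> linarith
  exact ⟨h𝒟 F h.left_mem F' h'.left_mem w w' hw0 hw0' hw hw' fun p hp => (key p hp).1,
    hℰ G h.right_mem G' h'.right_mem u u' hu0 hu0' hu hu' fun p hp => (key p hp).2⟩

variable {Q : Type v} {pos : Q → ℕ}

/-- The signed characteristic vector of an interval. -/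
def signedVec (pos : Q → ℕ) : (ℕ × ℕ) ⊕ (ℕ × ℕ) → Q → ℝ :=
  Sum.elim (fun q i => intervalVec q (pos i)) (fun q i => -intervalVec q (pos i))

/-- The simplex of a pair of sets of intervals. -/
def fanSimplex (pos : Q → ℕ) (F G : Finset (ℕ × ℕ)) : Set (Q → ℝ) :=
  convexHull ℝ ({0} ∪ signedVec pos '' (F.disjSum G))

/-- The bound on the total weight is dropped, since only membership in the cone matters for
uniqueness. -/
theorem exists_of_mem_fanSimplex {x : Q → ℝ} (hx : x ∈ fanSimplex pos F G) :
    ∃ w : (ℕ × ℕ) ⊕ (ℕ × ℕ) → ℝ, (∀ κ, 0 ≤ w κ) ∧ (∀ κ, w κ ≠ 0 → κ ∈ F.disjSum G) ∧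
      ∑ κ ∈ F.disjSum G, w κ • signedVec pos κ = x := by
  classical
  have h : signedVec pos '' (F.disjSum G) =
      Set.range fun κ : F.disjSum G => signedVec pos κ := by
    ext y
    simp
  rw [fanSimplex, h, convexHull_zero_union_range] at hx
  obtain ⟨w, hw0, -, rfl⟩ := hx
  refine ⟨fun κ => if hκ : κ ∈ F.disjSum G then w ⟨κ, hκ⟩ else 0, fun κ => ?_, fun κ hκ => ?_, ?_⟩
  · dsimp only
    split_ifs
    · exact hw0 _
    · exact le_rfl
  · by_contra h
    exact hκ (dif_neg h)
  · rw [← Finset.sum_coe_sort]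
    refine Finset.sum_congr rfl fun κ _ => ?_
    dsimp only
    rw [dif_pos κ.2]

theorem sum_disjSum_signedVec (w : (ℕ × ℕ) ⊕ (ℕ × ℕ) → ℝ) (i : Q) :
    (∑ κ ∈ F.disjSum G, w κ • signedVec pos κ) i =
      ∑ q ∈ F, w (Sum.inl q) * intervalVec q (pos i) -
        ∑ q ∈ G, w (Sum.inr q) * intervalVec q (pos i) := by
  rw [Finset.sum_apply, Finset.sum_disjSum, sub_eq_add_neg, ← Finset.sum_neg_distrib]
  simp [signedVec]

theorem IsFanPair.signed_unique (hsurj : ∀ p < n, ∃ i, pos i = p)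
    (h𝒟 : HasUniqueCombinations n 𝒟) (hℰ : HasUniqueCombinations n ℰ)
    (h : IsFanPair n 𝒟 ℰ F G) (h' : IsFanPair n 𝒟 ℰ F' G') {w w' : (ℕ × ℕ) ⊕ (ℕ × ℕ) → ℝ}
    (hw0 : ∀ κ, 0 ≤ w κ) (hw0' : ∀ κ, 0 ≤ w' κ) (hw : ∀ κ, w κ ≠ 0 → κ ∈ F.disjSum G)
    (hw' : ∀ κ, w' κ ≠ 0 → κ ∈ F'.disjSum G')
    (heq : ∑ κ ∈ F.disjSum G, w κ • signedVec pos κ =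
      ∑ κ ∈ F'.disjSum G', w' κ • signedVec pos κ) : w = w' := by
  have := IsFanPair.unique h𝒟 hℰ h h' (w := w ∘ Sum.inl) (u := w ∘ Sum.inr)
    (w' := w' ∘ Sum.inl) (u' := w' ∘ Sum.inr) (fun _ => hw0 _) (fun _ => hw0 _) (fun _ => hw0' _)
    (fun _ => hw0' _) (fun q hq => Finset.inl_mem_disjSum.1 (hw _ hq))
    (fun q hq => Finset.inr_mem_disjSum.1 (hw _ hq))
    (fun q hq => Finset.inl_mem_disjSum.1 (hw' _ hq))
    (fun q hq => Finset.inr_mem_disjSum.1 (hw' _ hq)) (fun p hp => by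
      obtain ⟨i, rfl⟩ := hsurj p hp
      have := congrFun heq i
      rwa [sum_disjSum_signedVec, sum_disjSum_signedVec] at this)
  funext κ
  rcases κ with q | q
  · exact congrFun this.1 q
  · exact congrFun this.2 q

/-- The positive and negative parts of a linear relation are two nonnegative combinations with the
same value, hence equal. -/
theorem IsFanPair.linearIndependent (hsurj : ∀ p < n, ∃ i, pos i = p)
    (h𝒟 : HasUniqueCombinations n 𝒟) (hℰ : HasUniqueCombinations n ℰ)
    (h : IsFanPair n 𝒟 ℰ F G) :
    LinearIndependent ℝ fun κ : F.disjSum G => signedVec pos κ := by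
  classical
  rw [Fintype.linearIndependent_iff]
  intro g hg
  let g' : (ℕ × ℕ) ⊕ (ℕ × ℕ) → ℝ := fun κ => if hκ : κ ∈ F.disjSum G then g ⟨κ, hκ⟩ else 0
  have hg' : ∀ κ : F.disjSum G, g' κ = g κ := fun κ => dif_pos κ.2
  have hmem : ∀ κ, g' κ ≠ 0 → κ ∈ F.disjSum G := fun κ hκ => by
    by_contra h
    exact hκ (dif_neg h)
  have hsum : ∑ κ ∈ F.disjSum G, g' κ • signedVec pos κ = 0 := by
    rw [← Finset.sum_coe_sort, ← hg]
    exact Finset.sum_congr rfl fun κ _ => by rw [hg']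
  have key := IsFanPair.signed_unique hsurj h𝒟 hℰ h h (w := fun κ => max (g' κ) 0)
    (w' := fun κ => max (-g' κ) 0) (fun _ => le_max_right _ _) (fun _ => le_max_right _ _)
    (fun κ hκ => hmem κ fun h0 => hκ (by simp [h0]))
    (fun κ hκ => hmem κ fun h0 => hκ (by simp [h0])) (by
      rw [← sub_eq_zero, ← Finset.sum_sub_distrib, ← hsum]
      refine Finset.sum_congr rfl fun κ _ => ?_
      rw [← sub_smul, max_zero_sub_max_neg_zero_eq_self])
  intro κ
  rw [← hg', ← max_zero_sub_max_neg_zero_eq_self (g' κ)]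
  exact sub_eq_zero.2 (congrFun key κ)

/-- The characteristic vector of the positions below `p`. -/
def prefixVec (pos : Q → ℕ) (p : ℕ) : Q → ℤ := fun i => if pos i < p then 1 else 0

/-- The signed characteristic vector of an interval, with integral entries. -/
def signedVecInt (pos : Q → ℕ) : (ℕ × ℕ) ⊕ (ℕ × ℕ) → Q → ℤ :=
  Sum.elim (fun q => prefixVec pos (q.2 + 1) - prefixVec pos q.1)
    (fun q => prefixVec pos q.1 - prefixVec pos (q.2 + 1))

theorem intervalVec_eq_prefixVec {q : ℕ × ℕ} (hq : q.1 ≤ q.2) (i : Q) :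
    intervalVec q (pos i) = ((prefixVec pos (q.2 + 1) - prefixVec pos q.1) i : ℤ) := by
  simp only [intervalVec, prefixVec, Pi.sub_apply]
  split_ifs <;> first | omega | simp

theorem IsFanPair.signedVec_eq (h : IsFanPair n 𝒟 ℰ F G) {κ : (ℕ × ℕ) ⊕ (ℕ × ℕ)}
    (hκ : κ ∈ F.disjSum G) (i : Q) : signedVec pos κ i = (signedVecInt pos κ i : ℤ) := by
  rcases κ with q | q
  · exact intervalVec_eq_prefixVec (h.left_valid q (Finset.inl_mem_disjSum.1 hκ)).1 i
  · change -intervalVec q (pos i) = _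
    rw [intervalVec_eq_prefixVec (h.right_valid q (Finset.inr_mem_disjSum.1 hκ)).1 i, ← Int.cast_neg]
    simp [signedVecInt]

/-- Regard `0, …, n` as nodes of a graph; a generator is, up to sign, the difference of the prefix
vectors at the ends of an edge. Spanning over `ℝ` makes the graph connected, and then every prefix
vector is an integral combination of generators, starting from the zero vector at node `0`. -/
theorem IsFanPair.span_int_eq_top [Fintype Q] (hinj : Function.Injective pos)
    (hlt : ∀ i, pos i < n) (hsurj : ∀ p < n, ∃ i, pos i = p) (h : IsFanPair n 𝒟 ℰ F G)
    (hspan : Submodule.span ℝ (Set.range fun κ : F.disjSum G => signedVec pos κ) = ⊤) :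
    Submodule.span ℤ (Set.range fun κ : F.disjSum G => signedVecInt pos κ) = ⊤ := by
  classical
  set N := Submodule.span ℤ (Set.range fun κ : F.disjSum G => signedVecInt pos κ) with hN
  have hmem : ∀ κ ∈ F.disjSum G, signedVecInt pos κ ∈ N := fun κ hκ =>
    Submodule.subset_span ⟨⟨κ, hκ⟩, rfl⟩
  -- `f` is constant along edges. The functional `η` built from its increments sends the prefix
  -- vector at `p` to `f p - f 0`, so it kills every generator and vanishes; therefore `f` is
  -- constantly `f 0 = 1` on the nodes.
  let f : ℕ → ℝ := fun p => if prefixVec pos p ∈ N then 1 else 0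
  have hf : ∀ p p', prefixVec pos p - prefixVec pos p' ∈ N → f p = f p' := by
    intro p p' hpp
    have : prefixVec pos p ∈ N ↔ prefixVec pos p' ∈ N :=
      ⟨fun h => by simpa using N.sub_mem h hpp, fun h => by simpa using N.add_mem hpp h⟩
    simp only [f, this]
  let η : (Q → ℝ) →ₗ[ℝ] ℝ := ∑ i, (f (pos i + 1) - f (pos i)) • LinearMap.proj i
  have hη : ∀ x, η x = ∑ i, (f (pos i + 1) - f (pos i)) * x i := fun x => by
    simp [η, LinearMap.sum_apply]
  have hsumQ : ∀ g : ℕ → ℝ, ∑ i, g (pos i) = ∑ p ∈ Finset.range n, g p := by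
    intro g
    refine Finset.sum_nbij pos (fun i _ => Finset.mem_range.2 (hlt i)) hinj.injOn ?_
      (fun _ _ => rfl)
    intro p hp
    obtain ⟨i, rfl⟩ := hsurj p (Finset.mem_range.1 hp)
    exact ⟨i, Finset.mem_univ _, rfl⟩
  have hpre : ∀ p ≤ n, η (fun i => (prefixVec pos p i : ℝ)) = f p - f 0 := by
    intro p hp
    rw [hη, ← Finset.sum_range_sub f p]
    simp only [prefixVec]
    rw [hsumQ fun q => (f (q + 1) - f q) * ((if q < p then 1 else 0 : ℤ) : ℝ)]
    have : ∀ q ∈ Finset.range n, (f (q + 1) - f q) * ((if q < p then 1 else 0 : ℤ) : ℝ) =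
        if q < p then f (q + 1) - f q else 0 := fun q _ => by split_ifs <;> simp
    rw [Finset.sum_congr rfl this, ← Finset.sum_filter]
    congr 1
    ext q
    simp only [Finset.mem_filter, Finset.mem_range]
    omega
  have hdiff : ∀ p p', p ≤ n → p' ≤ n →
      η (fun i => ((prefixVec pos p - prefixVec pos p') i : ℝ)) = f p - f p' := by
    intro p p' hp hp'
    have : (fun i => ((prefixVec pos p - prefixVec pos p') i : ℝ)) =
        (fun i => (prefixVec pos p i : ℝ)) - fun i => (prefixVec pos p' i : ℝ) := by
      funext i
      simp
    rw [this, map_sub, hpre p hp, hpre p' hp']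
    ring
  have hη0 : η = 0 := by
    apply LinearMap.ext_on_range hspan
    rintro ⟨κ, hκ⟩
    have hκN := hmem κ hκ
    rw [funext (h.signedVec_eq hκ)]
    rcases κ with q | q
    · have hq := h.left_valid q (Finset.inl_mem_disjSum.1 hκ)
      exact (hdiff _ _ (by omega) (by omega)).trans (sub_eq_zero.2 (hf _ _ hκN))
    · have hq := h.right_valid q (Finset.inr_mem_disjSum.1 hκ)
      exact (hdiff _ _ (by omega) (by omega)).trans (sub_eq_zero.2 (hf _ _ hκN))
  have hf0 : f 0 = 1 := by
    have : prefixVec pos 0 = 0 := by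
      funext i
      simp [prefixVec]
    simp [f, this]
  have hall : ∀ p ≤ n, prefixVec pos p ∈ N := by
    intro p hp
    have h1 := hpre p hp
    rw [hη0, LinearMap.zero_apply, hf0] at h1
    by_contra h0
    simp [f, h0] at h1
  have hsingle : ∀ i, (Pi.single i 1 : Q → ℤ) ∈ N := by
    intro i
    have : (Pi.single i 1 : Q → ℤ) = prefixVec pos (pos i + 1) - prefixVec pos (pos i) := by
      funext j
      rw [Pi.single_apply]
      simp only [prefixVec, Pi.sub_apply]
      have : j = i ↔ pos j = pos i := hinj.eq_iff.symm
      simp only [this]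
      split_ifs <;> omega
    rw [this]
    exact N.sub_mem (hall _ (hlt i)) (hall _ (hlt i).le)
  rw [eq_top_iff]
  intro x _
  have : x = ∑ i, x i • (Pi.single i 1 : Q → ℤ) := by
    ext j
    simp [Finset.sum_apply, Pi.single_apply]
  rw [this]
  exact N.sum_mem fun i _ => N.smul_mem _ (hsingle i)

theorem IsFanPair.isUnimodularSimplex [Fintype Q] (hinj : Function.Injective pos)
    (hlt : ∀ i, pos i < n) (hsurj : ∀ p < n, ∃ i, pos i = p) (hcard : Fintype.card Q = n)
    (h𝒟 : HasUniqueCombinations n 𝒟) (hℰ : HasUniqueCombinations n ℰ)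
    (h : IsFanPair n 𝒟 ℰ F G) : IsUnimodularSimplex (fanSimplex pos F G) := by
  have hli := h.linearIndependent (pos := pos) hsurj h𝒟 hℰ
  have hc : Fintype.card (F.disjSum G) = Fintype.card Q := by
    rw [Fintype.card_coe, Finset.card_disjSum, h.card, hcard]
  have hspan := h.span_int_eq_top hinj hlt hsurj (hli.span_eq_top_of_card_eq_finrank' (by
    rw [hc, Module.finrank_fintype_fun_eq_card]))
  have hliZ : LinearIndependent ℤ fun κ : F.disjSum G => signedVecInt pos κ := by
    have h1 : LinearIndependent ℤ fun κ : F.disjSum G => signedVec pos κ :=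
      hli.restrict_scalars (by
        intro a b hab
        simpa using hab)
    let c : (Q → ℤ) →ₗ[ℤ] (Q → ℝ) := (Int.castAddHom ℝ).toIntLinearMap.compLeft Q
    refine LinearIndependent.of_comp c ?_
    have : (c ∘ fun κ : F.disjSum G => signedVecInt pos κ) =
        fun κ : F.disjSum G => signedVec pos κ := by
      funext κ i
      exact (h.signedVec_eq κ.2 i).symm
    rwa [this]
  let e : F.disjSum G ≃ Q := Fintype.equivOfCardEq hc
  refine ⟨(Module.Basis.mk hliZ hspan.ge).reindex e, ?_⟩
  rw [fanSimplex]
  congr 2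
  have h2 : (fun x i => (((Module.Basis.mk hliZ hspan.ge).reindex e x i : ℤ) : ℝ)) =
      fun x => signedVec pos (e.symm x).1 := by
    funext x i
    rw [Module.Basis.reindex_apply, Module.Basis.mk_apply, h.signedVec_eq (e.symm x).2 i]
  rw [h2]
  ext y
  constructor
  · rintro ⟨κ, hκ, rfl⟩
    exact ⟨e ⟨κ, hκ⟩, by simp⟩
  · rintro ⟨x, rfl⟩
    exact ⟨_, (e.symm x).2, rfl⟩

/-- By uniqueness a common point has the same weights in both simplices, so it lies in the span of
the common generators, a proper subspace. -/
theorem IsFanPair.volume_inter_eq_zero [Fintype Q] (hsurj : ∀ p < n, ∃ i, pos i = p)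
    (hcard : Fintype.card Q = n)
    (h𝒟 : HasUniqueCombinations n 𝒟) (hℰ : HasUniqueCombinations n ℰ)
    (h : IsFanPair n 𝒟 ℰ F G) (h' : IsFanPair n 𝒟 ℰ F' G') (hne : ¬ (F = F' ∧ G = G')) :
    volume (fanSimplex pos F G ∩ fanSimplex pos F' G') = 0 := by
  classical
  set S := F.disjSum G
  set S' := F'.disjSum G'
  have hS : S.card = n := by rw [Finset.card_disjSum, h.card]
  have hS' : S'.card = n := by rw [Finset.card_disjSum, h'.card]
  have hSS : S ≠ S' := fun he => hne ⟨by
    ext q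
    have : Sum.inl q ∈ S ↔ Sum.inl q ∈ S' := by rw [he]
    simpa only [S, S', Finset.inl_mem_disjSum] using this, by
    ext q
    have : Sum.inr q ∈ S ↔ Sum.inr q ∈ S' := by rw [he]
    simpa only [S, S', Finset.inr_mem_disjSum] using this⟩
  have hlt : (S ∩ S').card < n := by
    rw [← hS]
    refine Finset.card_lt_card ⟨Finset.inter_subset_left, fun hle => hSS ?_⟩
    exact Finset.eq_of_subset_of_card_le (hle.trans Finset.inter_subset_right) (by rw [hS, hS'])
  let P := Submodule.span ℝ (((S ∩ S').image (signedVec pos) : Finset (Q → ℝ)) : Set (Q → ℝ))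
  have hP : P ≠ ⊤ := by
    intro hP
    have h1 : Module.finrank ℝ P ≤ ((S ∩ S').image (signedVec pos)).card :=
      finrank_span_finset_le_card _
    rw [hP, finrank_top, Module.finrank_fintype_fun_eq_card, hcard] at h1
    exact absurd (h1.trans Finset.card_image_le) (by omega)
  refine measure_mono_null ?_ (Measure.addHaar_submodule volume P hP)
  rintro x ⟨hx, hx'⟩
  obtain ⟨w, hw0, hw, hwx⟩ := exists_of_mem_fanSimplex hx
  obtain ⟨w', hw0', hw', hwx'⟩ := exists_of_mem_fanSimplex hx'
  obtain rfl := IsFanPair.signed_unique hsurj h𝒟 hℰ h h' hw0 hw0' hw hw' (hwx.trans hwx'.symm)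
  rw [← hwx]
  refine P.sum_mem fun κ _ => ?_
  by_cases h0 : w κ = 0
  · rw [h0, zero_smul]
    exact P.zero_mem
  · refine P.smul_mem _ (Submodule.subset_span ?_)
    exact Finset.mem_coe.2 (Finset.mem_image_of_mem _
      (Finset.mem_inter.2 ⟨hw κ h0, hw' κ h0⟩))

theorem isCompact_fanSimplex [Finite Q] : IsCompact (fanSimplex pos F G) := by
  have := Fintype.ofFinite Q
  exact Set.Finite.isCompact_convexHull ℝ
    ((Set.finite_singleton _).union ((Finset.finite_toSet _).image _))

/-- The counting principle: objects classified by fan pairs are counted by the volume of the union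
of their simplices. -/
theorem volume_eq_ncard_of_isFanPair [Fintype Q] (hinj : Function.Injective pos)
    (hlt : ∀ i, pos i < n) (hsurj : ∀ p < n, ∃ i, pos i = p) (hcard : Fintype.card Q = n)
    (h𝒟 : HasUniqueCombinations n 𝒟) (hℰ : HasUniqueCombinations n ℰ)
    {𝒯 : Type*} {C : Type*} (cls : 𝒯 → C) (P : 𝒯 → Prop) (σ : 𝒯 → Set (Q → ℝ))
    (hσ : ∀ T T', cls T = cls T' → σ T = σ T')
    (code : 𝒯 → Finset (ℕ × ℕ) → Finset (ℕ × ℕ) → Prop)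
    (hex : ∀ T, P T → ∃ F G, code T F G)
    (hfan : ∀ T F G, code T F G → IsFanPair n 𝒟 ℰ F G ∧ σ T = fanSimplex pos F G)
    (hcls : ∀ T T' F G, code T F G → code T' F G → cls T = cls T') :
    ({c | ∃ T, P T ∧ cls T = c}.Finite ∧
      integralVolume {x | ∃ T, P T ∧ x ∈ σ T} = ({c | ∃ T, P T ∧ cls T = c}.ncard : ℝ≥0∞)) ∧
    (∀ T, P T → IsUnimodularSimplex (σ T) ∧ integralVolume (σ T) = 1) ∧
    (∀ T T', P T → P T' → cls T ≠ cls T' → volume (σ T ∩ σ T') = 0) := by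
  classical
  have huni : ∀ T, P T → IsUnimodularSimplex (σ T) := by
    intro T hT
    obtain ⟨F, G, hc⟩ := hex T hT
    obtain ⟨h, hs⟩ := hfan T F G hc
    rw [hs]
    exact h.isUnimodularSimplex hinj hlt hsurj hcard h𝒟 hℰ
  have hdisj : ∀ T T', P T → P T' → cls T ≠ cls T' → volume (σ T ∩ σ T') = 0 := by
    intro T T' hT hT' hne
    obtain ⟨F, G, hc⟩ := hex T hT
    obtain ⟨F', G', hc'⟩ := hex T' hT'
    obtain ⟨h, hs⟩ := hfan T F G hc
    obtain ⟨h', hs'⟩ := hfan T' F' G' hc'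
    rw [hs, hs']
    refine h.volume_inter_eq_zero hsurj hcard h𝒟 hℰ h' ?_
    rintro ⟨rfl, rfl⟩
    exact hne (hcls T T' F G hc hc')
  set Cl : Set C := {c | ∃ T, P T ∧ cls T = c} with hCl
  -- Choosing representatives as a total function on `C` needs a default object.
  rcases isEmpty_or_nonempty 𝒯 with hemp | hemp
  · have : Cl = ∅ := Set.eq_empty_of_forall_notMem fun c hc => hemp.elim hc.choose
    refine ⟨⟨by simp [this], ?_⟩, fun T => hemp.elim T, fun T => hemp.elim T⟩
    simp [this, integralVolume]
  choose! rep hrepP hrep using fun (c : C) (hc : c ∈ Cl) => hc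
  have hfin : Cl.Finite := by
    choose! f g hfg using hex
    let V : Finset (Finset (ℕ × ℕ)) := (Finset.range n ×ˢ Finset.range n).powerset
    -- Codes are pairs of subsets of a finite set of intervals, and a class is determined by the
    -- code of its representative.
    have hV : ∀ F : Finset (ℕ × ℕ), (∀ q ∈ F, q.1 ≤ q.2 ∧ q.2 < n) → F ∈ V := by
      intro F hF
      refine Finset.mem_powerset.2 fun q hq => ?_
      have := hF q hq
      simp only [Finset.mem_product, Finset.mem_range]
      omega
    refine Set.Finite.of_finite_image (f := fun c => (f (rep c), g (rep c)))
      ((V ×ˢ V).finite_toSet.subset ?_) ?_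
    · rintro _ ⟨c, hc, rfl⟩
      have h := (hfan _ _ _ (hfg _ (hrepP c hc))).1
      exact Finset.mem_coe.2 (Finset.mem_product.2 ⟨hV _ h.left_valid, hV _ h.right_valid⟩)
    · intro c hc c' hc' he
      rw [← hrep c hc, ← hrep c' hc']
      have h1 := hfg _ (hrepP c hc)
      obtain ⟨he1, he2⟩ := Prod.mk.inj he
      rw [he1, he2] at h1
      exact hcls _ _ _ _ h1 (hfg _ (hrepP c' hc'))
  refine ⟨⟨hfin, ?_⟩, fun T hT => ⟨huni T hT, (huni T hT).integralVolume_eq_one⟩, hdisj⟩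
  have hU : {x | ∃ T, P T ∧ x ∈ σ T} = ⋃ c ∈ hfin.toFinset, σ (rep c) := by
    ext x
    simp only [Set.mem_ofPred_eq, Set.mem_iUnion, Set.Finite.mem_toFinset, exists_prop]
    constructor
    · rintro ⟨T, hT, hx⟩
      have hc : cls T ∈ Cl := ⟨T, hT, rfl⟩
      exact ⟨cls T, hc, by rwa [hσ _ _ (hrep _ hc)]⟩
    · rintro ⟨c, hc, hx⟩
      exact ⟨rep c, hrepP c hc, hx⟩
  rw [hU, integralVolume, measure_biUnion_finset₀]
  · rw [Finset.mul_sum, Set.ncard_eq_toFinset_card _ hfin, Finset.card_eq_sum_ones, Nat.cast_sum]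
    refine Finset.sum_congr rfl fun c hc => ?_
    rw [Nat.cast_one]
    exact (huni _ (hrepP c (hfin.mem_toFinset.1 hc))).integralVolume_eq_one
  · intro c hc c' hc' hne
    have hc := hfin.mem_toFinset.1 hc
    have hc' := hfin.mem_toFinset.1 hc'
    refine hdisj _ _ (hrepP c hc) (hrepP c' hc') ?_
    rwa [hrep c hc, hrep c' hc']
  · intro c hc
    obtain ⟨F, G, hcode⟩ := hex _ (hrepP c (hfin.mem_toFinset.1 hc))
    rw [(hfan _ F G hcode).2]
    exact isCompact_fanSimplex.measurableSet.nullMeasurableSet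

end Fan

end QuiverRep

namespace QuiverRep

/-! ### Isomorphism invariance and summands of direct sums. -/

section IsoInvariance

variable {k : Type u} [Field k] {Q : Type v} [Quiver.{w} Q]

theorem isoClass_eq_iff {V W : QuiverRep k Q} : V.isoClass = W.isoClass ↔ IsIsomorphic V W :=
  Quotient.eq (r := isoSetoid k Q)

theorem IsIsomorphic.summandDims_eq {V W : QuiverRep k Q} (h : IsIsomorphic V W) :
    V.summandDims = W.summandDims := by
  ext d
  constructor
  · rintro ⟨M, hM, ⟨N, hN⟩, hd⟩
    exact ⟨M, hM, ⟨N, h.symm.trans hN⟩, hd⟩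
  · rintro ⟨M, hM, ⟨N, hN⟩, hd⟩
    exact ⟨M, hM, ⟨N, h.trans hN⟩, hd⟩

theorem isSummand_directSum {ι : Type} [Finite ι] (M : ι → QuiverRep k Q) (y : ι) :
    IsSummand (M y) (directSum M) := by
  classical
  let e := Equiv.optionSubtypeNe y
  refine ⟨directSum fun x : {x // x ≠ y} => M x, (IsIsomorphic.directSum_reindex e M).trans
    (IsIsomorphic.trans (IsIsomorphic.directSum_congr ?_) (IsIsomorphic.prod_directSum _ _).symm)⟩
  rintro (_ | x)
  · exact IsIsomorphic.refl _
  · exact IsIsomorphic.refl _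

theorem finrank_directSum {ι : Type} [Fintype ι] (M : ι → QuiverRep k Q) (i : Q) :
    Module.finrank k ((directSum M).space i) = ∑ y, Module.finrank k ((M y).space i) :=
  Module.finrank_pi_fintype k

end IsoInvariance

/-! ### Rigid representations as sums of intervals. -/

section IntervalSum

variable {k : Type u} [Field k]

theorem thin_interval_dimVec {Q : Type v} [Quiver.{w} Q] (pos : Q → ℕ) (p : ℕ × ℕ) :
    (thin k (interval pos p)).dimVec = fun i => intervalVec p (pos i) := by
  classical
  funext i
  simp only [dimVec, thin_finrank, intervalVec]
  by_cases h : i ∈ interval pos p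
  · rw [if_pos h, if_pos (And.intro h.1 h.2), Nat.cast_one]
  · rw [if_neg h, if_neg (fun h' : p.1 ≤ pos i ∧ pos i ≤ p.2 => h h'), Nat.cast_zero]

theorem IsLinear.exists_finset {Q : Type v} [Quiver.{w} Q] [Finite Q] {pos : Q → ℕ}
    {dir : ℕ → Bool} (hQ : IsLinear Q pos dir) {m : ℕ} (M : Fin m → QuiverRep k Q)
    (hM : ∀ x, (M x).IsIndecomposable) (hne : ∀ x y, x ≠ y → ¬ IsIsomorphic (M x) (M y)) :
    ∃ F : Finset (ℕ × ℕ), F.card = m ∧ (∀ q ∈ F, IsOccupied pos q) ∧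
      IsIsomorphic (directSum M) (directSum fun q : F => thin k (interval pos q)) := by
  classical
  choose p hp hiso using fun x => hQ.indecomposable_isIsomorphic_thin (hM x)
  have hinj : Function.Injective p := by
    intro x y hxy
    by_contra h
    refine hne x y h ((hiso x).trans ?_)
    rw [hxy]
    exact (hiso y).symm
  let e : Fin m ≃ Finset.univ.image p :=
    (Equiv.ofInjective p hinj).trans (Equiv.subtypeEquivRight fun q => by simp)
  -- The summands are pairwise non-isomorphic, so their intervals are distinct and form a set of the
  -- right cardinality.
  refine ⟨Finset.univ.image p, ?_, ?_, ?_⟩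
  · rw [Finset.card_image_of_injective _ hinj, Finset.card_univ, Fintype.card_fin]
  · intro q hq
    obtain ⟨x, -, rfl⟩ := Finset.mem_image.1 hq
    exact hp x
  · refine IsIsomorphic.trans (IsIsomorphic.directSum_congr hiso) ?_
    exact (IsIsomorphic.directSum_reindex e
      fun q : Finset.univ.image p => thin k (interval pos q)).symm

variable {n : ℕ} {o : Fin (n - 1) → Bool}

theorem dimVec_directSum_thin {ι : Type} [Fintype ι] (p : ι → ℕ × ℕ) (i : TypeA n o) :
    (directSum fun y => thin k (interval (TypeA.pos (n := n) (o := o)) (p y))).dimVec i =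
      ∑ y, intervalVec (p y) i.pos := by
  rw [dimVec, finrank_directSum, Nat.cast_sum]
  exact Finset.sum_congr rfl fun y _ => congrFun (thin_interval_dimVec _ _) i

theorem IsRigid.extVanishes_of_retract {T : QuiverRep k (TypeA n o)} (hT : T.IsRigid)
    {p q : ℕ × ℕ} (hp : IsOccupied (TypeA.pos (n := n) (o := o)) p)
    (hq : IsOccupied (TypeA.pos (n := n) (o := o)) q)
    (h : IsRetract (thin k (interval TypeA.pos p)) T)
    (h' : IsRetract (thin k (interval TypeA.pos q)) T) :
    ExtVanishes k (TypeA.dir o) p q :=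
  extVanishes_of_surjective TypeA.isLinear hp hq
    (extMap_surjective_of_isRetract h h' ((isRigid_iff T).1 hT))

theorem IsRigid.image_mem_compatibleSets {T : QuiverRep k (TypeA n o)} (hT : T.IsRigid)
    {ι : Type} [Fintype ι] {p : ι → ℕ × ℕ}
    (hp : ∀ y, IsOccupied (TypeA.pos (n := n) (o := o)) (p y))
    (hiso : IsIsomorphic T (directSum fun y => thin k (interval TypeA.pos (p y)))) :
    Finset.univ.image p ∈ compatibleSets k (TypeA.dir o) n := by
  have hret : ∀ y, IsRetract (thin k (interval TypeA.pos (p y))) T := fun y =>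
    (isRetract_directSum (fun y => thin k (interval TypeA.pos (p y))) y).trans
      hiso.symm.isRetract
  constructor
  · intro q hq
    obtain ⟨y, -, rfl⟩ := Finset.mem_image.1 hq
    exact TypeA.isOccupied_iff.1 (hp y)
  · intro q hq r hr
    obtain ⟨y, -, rfl⟩ := Finset.mem_image.1 hq
    obtain ⟨z, -, rfl⟩ := Finset.mem_image.1 hr
    exact hT.extVanishes_of_retract (hp y) (hp z) (hret y) (hret z)

/-- The intervals in a decomposition of a rigid representation are determined by it. -/
theorem IsRigid.image_unique {T : QuiverRep k (TypeA n o)} (hT : T.IsRigid)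
    {ι κ : Type} [Fintype ι] [Fintype κ] {p : ι → ℕ × ℕ} {q : κ → ℕ × ℕ}
    (hp : ∀ y, IsOccupied (TypeA.pos (n := n) (o := o)) (p y))
    (hq : ∀ y, IsOccupied (TypeA.pos (n := n) (o := o)) (q y))
    (hisop : IsIsomorphic T (directSum fun y => thin k (interval TypeA.pos (p y))))
    (hisoq : IsIsomorphic T (directSum fun y => thin k (interval TypeA.pos (q y)))) :
    Finset.univ.image p = Finset.univ.image q := by
  classical
  have hne : ∀ {ι : Type} [Fintype ι] (p : ι → ℕ × ℕ) (c : ℕ × ℕ),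
      ((Finset.univ.filter fun y => p y = c).card : ℝ) ≠ 0 ↔ c ∈ Finset.univ.image p := by
    intro ι _ p c
    rw [Nat.cast_ne_zero, Finset.card_ne_zero]
    simp [Finset.filter_nonempty_iff]
  have hsum : ∀ {ι : Type} [Fintype ι] (p : ι → ℕ × ℕ) (x : ℕ),
      ∑ c ∈ Finset.univ.image p, ((Finset.univ.filter fun y => p y = c).card : ℝ) *
        intervalVec c x = ∑ y, intervalVec (p y) x := by
    intro ι _ p x
    rw [Finset.sum_comp (fun c => intervalVec c x) p]
    simp [nsmul_eq_mul]
  -- The multiplicities in the two decompositions are nonnegative weights on compatible sets, and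
  -- both express the dimension vector of `T`.
  have key := hasUniqueCombinations_compatibleSets k (TypeA.dir o) n _
    (hT.image_mem_compatibleSets hp hisop) _ (hT.image_mem_compatibleSets hq hisoq)
    (fun c => ((Finset.univ.filter fun y => p y = c).card : ℝ))
    (fun c => ((Finset.univ.filter fun y => q y = c).card : ℝ))
    (fun _ => Nat.cast_nonneg _) (fun _ => Nat.cast_nonneg _)
    (fun c => (hne p c).1) (fun c => (hne q c).1) (fun x hx => by
      obtain ⟨i, rfl⟩ := TypeA.exists_pos_eq (o := o) hx
      rw [hsum, hsum]
      have h := congrFun ((hisop.symm.trans hisoq).dimVec_eq) i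
      rwa [dimVec_directSum_thin, dimVec_directSum_thin] at h)
  ext c
  rw [← hne, ← hne]
  exact not_congr (by rw [congrFun key c])

/-- A rigid representation that is the direct sum of the interval representations in `F`. -/
structure IsIntervalSum (T : QuiverRep k (TypeA n o)) (F : Finset (ℕ × ℕ)) : Prop where
  rigid : T.IsRigid
  valid : ∀ q ∈ F, IsOccupied (TypeA.pos (n := n) (o := o)) q
  iso : IsIsomorphic T (directSum fun q : F => thin k (interval TypeA.pos q))

variable {T : QuiverRep k (TypeA n o)} {F : Finset (ℕ × ℕ)}

theorem IsIntervalSum.mem_compatibleSets (h : IsIntervalSum T F) :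
    F ∈ compatibleSets k (TypeA.dir o) n := by
  have := h.rigid.image_mem_compatibleSets (p := fun q : F => q) (fun q => h.valid q q.2) h.iso
  simpa using this

/-- A complement of an indecomposable summand also splits into intervals, which yields a second
interval decomposition of `T`; `IsRigid.image_unique` then places the summand in `F`. -/
theorem IsIntervalSum.summandDims_eq (h : IsIntervalSum T F) :
    T.summandDims = {d | ∃ q ∈ F, d = fun i => intervalVec q i.pos} := by
  ext d
  constructor
  · rintro ⟨M, hM, ⟨N, hN⟩, rfl⟩
    obtain ⟨q, hq, hMq⟩ := TypeA.isLinear.indecomposable_isIsomorphic_thin hM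
    obtain ⟨ι, _, p, hp, hNp⟩ := TypeA.isLinear.exists_directSum_thin _ N rfl
    have hiso : IsIsomorphic T (directSum fun y : Option ι =>
        thin k (interval TypeA.pos (y.elim q p))) := by
      refine (hN.trans (hMq.prod_congr hNp)).trans
        ((IsIsomorphic.prod_directSum _ _).trans (IsIsomorphic.directSum_congr ?_))
      rintro (_ | y)
      · exact IsIsomorphic.refl _
      · exact IsIsomorphic.refl _
    have := h.rigid.image_unique (p := fun y : Option ι => y.elim q p) (q := fun r : F => r)
      (by rintro (_ | y); exacts [hq, hp y]) (fun r => h.valid r r.2) hiso h.iso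
    have hqF : q ∈ F := by
      have h1 : q ∈ Finset.univ.image fun y : Option ι => y.elim q p :=
        Finset.mem_image.2 ⟨none, Finset.mem_univ _, rfl⟩
      rw [this] at h1
      simpa using h1
    exact ⟨q, hqF, by rw [hMq.dimVec_eq, thin_interval_dimVec]⟩
  · rintro ⟨q, hq, rfl⟩
    obtain ⟨N, hN⟩ := isSummand_directSum (fun q : F => thin k (interval TypeA.pos q)) ⟨q, hq⟩
    exact ⟨thin k (interval TypeA.pos q), TypeA.isLinear.thin_isIndecomposable (h.valid q hq),
      ⟨N, h.iso.trans hN⟩, (thin_interval_dimVec _ _).symm⟩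

theorem support_directSum_thin (F : Finset (ℕ × ℕ)) :
    (directSum fun q : F => thin k (interval (TypeA.pos (n := n) (o := o)) q)).support =
      {i | ∃ q ∈ F, i ∈ interval TypeA.pos q} := by
  classical
  ext i
  rw [support, Set.mem_ofPred_eq, finrank_directSum]
  simp [thin_finrank]

theorem IsIntervalSum.support_eq (h : IsIntervalSum T F) :
    T.support = {i | ∃ q ∈ F, i ∈ interval TypeA.pos q} := by
  rw [h.iso.support_eq, support_directSum_thin]

theorem IsIntervalSum.isIsomorphic (h : IsIntervalSum T F) {T' : QuiverRep k (TypeA n o)}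
    (h' : IsIntervalSum T' F) : IsIsomorphic T T' := h.iso.trans h'.iso.symm

theorem IsTilting.exists_isIntervalSum (hT : T.IsTilting) :
    ∃ F, IsIntervalSum T F ∧ F.card = n := by
  obtain ⟨hrig, M, hM, hne, hiso⟩ := hT
  obtain ⟨F, hc, hF, hisoF⟩ := TypeA.isLinear.exists_finset M hM hne
  refine ⟨F, ⟨hrig, hF, hiso.trans hisoF⟩, hc.trans ?_⟩
  rw [Nat.card_eq_fintype_card]
  exact Fintype.card_fin n

/-- Intervals occupied by vertices of the support are occupied in the whole quiver, and outside the
support all spaces vanish, so the decomposition and rigidity lift from the restriction. -/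
theorem IsSupportTilting.exists_isIntervalSum (hT : T.IsSupportTilting) :
    ∃ F, IsIntervalSum T F ∧ F.card = Nat.card T.support := by
  obtain ⟨hrig, M, hM, hne, hiso⟩ := hT
  obtain ⟨F, hc, hF, hisoF⟩ := (TypeA.isLinear.subtype T.support).exists_finset M hM hne
  refine ⟨F, ⟨hrig.of_restrict subset_rfl, fun q hq => ?_, ?_⟩, hc⟩
  · refine ⟨(hF q hq).1, fun r h1 h2 => ?_⟩
    obtain ⟨i, hi⟩ := (hF q hq).2 r h1 h2
    exact ⟨i, hi⟩
  · refine IsIsomorphic.of_restrict (S := T.support) subset_rfl ?_ (hiso.trans hisoF)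
    rw [support_directSum_thin]
    rintro i ⟨q, hq, hi⟩
    obtain ⟨j, hj⟩ := (hF q hq).2 i.pos hi.1 hi.2
    have : (j : TypeA n o) = i := TypeA.isLinear.inj hj
    exact this ▸ j.2

end IntervalSum

/-! ### The three counts. -/

section Count

variable {k : Type u} [Field k] {n : ℕ} {o : Fin (n - 1) → Bool}

theorem IsIntervalSum.valid' {T : QuiverRep k (TypeA n o)} {F : Finset (ℕ × ℕ)}
    (h : IsIntervalSum T F) : ∀ q ∈ F, q.1 ≤ q.2 ∧ q.2 < n :=
  fun q hq => TypeA.isOccupied_iff.1 (h.valid q hq)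

theorem IsIntervalSum.mem_support {T : QuiverRep k (TypeA n o)} {F : Finset (ℕ × ℕ)}
    (h : IsIntervalSum T F) {q : ℕ × ℕ} (hq : q ∈ F) {i : TypeA n o}
    (hi : intervalVec q i.pos ≠ 0) : i ∈ T.support := by
  rw [h.support_eq]
  refine ⟨q, hq, ?_⟩
  by_contra h0
  exact hi (if_neg h0)

theorem fanSimplex_eq (F G : Finset (ℕ × ℕ)) :
    fanSimplex (TypeA.pos (n := n) (o := o)) F G =
      convexHull ℝ ({0} ∪ {d | ∃ q ∈ F, d = fun i => intervalVec q i.pos} ∪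
        {d | ∃ q ∈ G, d = fun i => -intervalVec q i.pos}) := by
  rw [fanSimplex, Set.union_assoc]
  congr 2
  ext d
  constructor
  · rintro ⟨q | q, hq, rfl⟩
    · exact Or.inl ⟨q, Finset.inl_mem_disjSum.1 hq, rfl⟩
    · exact Or.inr ⟨q, Finset.inr_mem_disjSum.1 hq, rfl⟩
  · rintro (⟨q, hq, rfl⟩ | ⟨q, hq, rfl⟩)
    · exact ⟨Sum.inl q, Finset.inl_mem_disjSum.2 hq, rfl⟩
    · exact ⟨Sum.inr q, Finset.inr_mem_disjSum.2 hq, rfl⟩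

/-- Turns disjointness of supports into the pointwise condition of `IsFanPair`; the bound on `F`
ensures that a position where both vectors are nonzero carries a vertex. -/
theorem disjoint_intervalVec_of_support {F G : Finset (ℕ × ℕ)}
    {A B : Set (TypeA n o)} (hAB : Disjoint A B)
    (hF : ∀ q ∈ F, q.2 < n)
    (hA : ∀ q ∈ F, ∀ i : TypeA n o, intervalVec q i.pos ≠ 0 → i ∈ A)
    (hB : ∀ q ∈ G, ∀ i : TypeA n o, intervalVec q i.pos ≠ 0 → i ∈ B) :
    ∀ q ∈ F, ∀ r ∈ G, ∀ p, intervalVec q p * intervalVec r p = 0 := by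
  intro q hq r hr p
  by_contra h0
  obtain ⟨h1, h2⟩ := mul_ne_zero_iff.1 h0
  have hp : p < n := by
    by_contra hp
    refine h1 (if_neg fun h => ?_)
    have := hF q hq
    omega
  obtain ⟨i, rfl⟩ := TypeA.exists_pos_eq (o := o) hp
  exact Set.disjoint_left.1 hAB (hA q hq i h1) (hB r hr i h2)

/-- The one-element intervals outside a set of vertices. -/
noncomputable def complSingletons (S : Set (TypeA n o)) : Finset (ℕ × ℕ) :=
  open Classical in (Finset.univ.filter (· ∉ S)).image fun i => (i.pos, i.pos)

theorem mem_complSingletons {S : Set (TypeA n o)} {q : ℕ × ℕ} :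
    q ∈ complSingletons S ↔ ∃ i ∉ S, (i.pos, i.pos) = q := by
  simp [complSingletons]

theorem card_complSingletons (S : Set (TypeA n o)) :
    Nat.card S + (complSingletons S).card = n := by
  classical
  rw [complSingletons, Finset.card_image_of_injective _ fun i j h =>
    TypeA.isLinear.inj (Prod.mk.inj h).1, Nat.card_eq_fintype_card, Fintype.card_subtype]
  refine (Finset.card_filter_add_card_filter_not (s := Finset.univ) (· ∈ S)).trans ?_
  rw [Finset.card_univ, TypeA.card_eq]

theorem tilting_count (k : Type u) [Field k] (n : ℕ) (o : Fin (n - 1) → Bool) :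
    ((tiltingClasses k (TypeA n o)).Finite ∧
      integralVolume (polyTilt k (TypeA n o)) =
        ((tiltingClasses k (TypeA n o)).ncard : ℝ≥0∞)) ∧
    (∀ T : QuiverRep k (TypeA n o), T.IsTilting →
      IsUnimodularSimplex T.simplexTilt ∧ integralVolume T.simplexTilt = 1) ∧
    (∀ T T' : QuiverRep k (TypeA n o), T.IsTilting → T'.IsTilting →
      T.isoClass ≠ T'.isoClass → volume (T.simplexTilt ∩ T'.simplexTilt) = 0) := by
  refine volume_eq_ncard_of_isFanPair (pos := TypeA.pos) (n := n) TypeA.isLinear.inj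
    TypeA.pos_lt (fun _ => TypeA.exists_pos_eq) TypeA.card_eq
    (hasUniqueCombinations_compatibleSets k (TypeA.dir o) n) (hasUniqueCombinations_singletonSets n)
    (𝒯 := QuiverRep k (TypeA n o)) isoClass IsTilting simplexTilt (fun T T' h => ?_)
    -- There is no negative part; the singleton family serves only as a trivial second component.
    (fun T F G => IsIntervalSum T F ∧ F.card = n ∧ G = ∅) (fun T hT => ?_) ?_ ?_
  · rw [simplexTilt, simplexTilt, (isoClass_eq_iff.1 h).summandDims_eq]
  · obtain ⟨F, h, hc⟩ := hT.exists_isIntervalSum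
    exact ⟨F, ∅, h, hc, rfl⟩
  · rintro T F _ ⟨h, hc, rfl⟩
    refine ⟨⟨h.mem_compatibleSets, by simp [singletonSets], by simp [hc], h.valid', by simp,
      by simp⟩, ?_⟩
    rw [simplexTilt, fanSimplex_eq, h.summandDims_eq]
    simp
  · rintro T T' F G ⟨h, -, -⟩ ⟨h', -, -⟩
    exact isoClass_eq_iff.2 (h.isIsomorphic h')

theorem supportTilting_count (k : Type u) [Field k] (n : ℕ) (o : Fin (n - 1) → Bool) :
    ((supportTiltingClasses k (TypeA n o)).Finite ∧
      integralVolume (polySupp k (TypeA n o)) =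
        ((supportTiltingClasses k (TypeA n o)).ncard : ℝ≥0∞)) ∧
    (∀ T : QuiverRep k (TypeA n o), T.IsSupportTilting →
      IsUnimodularSimplex T.simplexSupp ∧ integralVolume T.simplexSupp = 1) ∧
    (∀ T T' : QuiverRep k (TypeA n o), T.IsSupportTilting → T'.IsSupportTilting →
      T.isoClass ≠ T'.isoClass → volume (T.simplexSupp ∩ T'.simplexSupp) = 0) := by
  refine volume_eq_ncard_of_isFanPair (pos := TypeA.pos) (n := n) TypeA.isLinear.inj
    TypeA.pos_lt (fun _ => TypeA.exists_pos_eq) TypeA.card_eq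
    (hasUniqueCombinations_compatibleSets k (TypeA.dir o) n) (hasUniqueCombinations_singletonSets n)
    (𝒯 := QuiverRep k (TypeA n o)) isoClass IsSupportTilting simplexSupp (fun T T' h => ?_)
    -- The vectors `-e_j` are the negatives of one-point intervals, and there is one for each vertex
    -- missing from the support, which brings the number of generators to `n`.
    (fun T F G => IsIntervalSum T F ∧ F.card = Nat.card T.support ∧ G = complSingletons T.support)
    (fun T hT => ?_) ?_ ?_
  · rw [simplexSupp, simplexSupp, (isoClass_eq_iff.1 h).summandDims_eq,
      (isoClass_eq_iff.1 h).support_eq]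
  · obtain ⟨F, h, hc⟩ := hT.exists_isIntervalSum
    exact ⟨F, _, h, hc, rfl⟩
  · rintro T F _ ⟨h, hc, rfl⟩
    have hs : ∀ j i : TypeA n o,
        intervalVec (j.pos, j.pos) i.pos = Pi.single (M := fun _ => ℝ) j 1 i := by
      intro j i
      rw [Pi.single_apply, intervalVec]
      refine if_congr ?_ rfl rfl
      rw [← TypeA.isLinear.inj.eq_iff]
      dsimp only
      omega
    have hval : ∀ q ∈ complSingletons T.support, q.1 = q.2 ∧ q.2 < n := by
      intro q hq
      obtain ⟨i, -, rfl⟩ := mem_complSingletons.1 hq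
      exact ⟨rfl, TypeA.pos_lt i⟩
    refine ⟨⟨h.mem_compatibleSets, hval, by rw [hc, card_complSingletons], h.valid',
      fun q hq => ⟨(hval q hq).1.le, (hval q hq).2⟩,
      disjoint_intervalVec_of_support disjoint_compl_right (fun q hq => (h.valid' q hq).2)
        (fun q hq i hi => h.mem_support hq hi) fun q hq i hi => ?_⟩, ?_⟩
    · obtain ⟨j, hj, rfl⟩ := mem_complSingletons.1 hq
      rw [hs, Pi.single_apply] at hi
      obtain rfl : i = j := by
        by_contra h0
        exact hi (if_neg h0)
      exact hj
    · rw [simplexSupp, fanSimplex_eq, h.summandDims_eq]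
      congr 2
      ext d
      constructor
      · rintro ⟨j, hj, rfl⟩
        refine ⟨_, mem_complSingletons.2 ⟨j, hj, rfl⟩, ?_⟩
        funext i
        rw [hs, Pi.neg_apply]
      · rintro ⟨_, hq, rfl⟩
        obtain ⟨j, hj, rfl⟩ := mem_complSingletons.1 hq
        refine ⟨j, hj, ?_⟩
        funext i
        rw [hs, Pi.neg_apply]
  · rintro T T' F G ⟨h, -, -⟩ ⟨h', -, -⟩
    exact isoClass_eq_iff.2 (h.isIsomorphic h')

theorem twoSupportTilting_count (k : Type u) [Field k] (n : ℕ) (o : Fin (n - 1) → Bool) :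
    ((twoSupportTiltingClasses k (TypeA n o)).Finite ∧
      integralVolume (polyTwo k (TypeA n o)) =
        ((twoSupportTiltingClasses k (TypeA n o)).ncard : ℝ≥0∞)) ∧
    (∀ T : QuiverRep k (TypeA n o) × QuiverRep k (TypeA n o), IsTwoSupportTilting T →
      IsUnimodularSimplex (simplexTwo T) ∧ integralVolume (simplexTwo T) = 1) ∧
    (∀ T T' : QuiverRep k (TypeA n o) × QuiverRep k (TypeA n o),
      IsTwoSupportTilting T → IsTwoSupportTilting T' →
      (T.1.isoClass, T.2.isoClass) ≠ (T'.1.isoClass, T'.2.isoClass) →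
        volume (simplexTwo T ∩ simplexTwo T') = 0) := by
  refine volume_eq_ncard_of_isFanPair (pos := TypeA.pos) (n := n) TypeA.isLinear.inj
    TypeA.pos_lt (fun _ => TypeA.exists_pos_eq) TypeA.card_eq
    (hasUniqueCombinations_compatibleSets k (TypeA.dir o) n)
    (hasUniqueCombinations_compatibleSets k (TypeA.dir o) n)
    (𝒯 := QuiverRep k (TypeA n o) × QuiverRep k (TypeA n o))
    (fun T => (T.1.isoClass, T.2.isoClass)) IsTwoSupportTilting simplexTwo (fun T T' h => ?_)
    (fun T F G => IsIntervalSum T.1 F ∧ IsIntervalSum T.2 G ∧ F.card = Nat.card T.1.support ∧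
      G.card = Nat.card T.2.support ∧ IsCompl T.1.support T.2.support)
    (fun T hT => ?_) ?_ ?_
  · obtain ⟨h1, h2⟩ := Prod.mk.inj h
    rw [simplexTwo, simplexTwo, (isoClass_eq_iff.1 h1).summandDims_eq,
      (isoClass_eq_iff.1 h2).summandDims_eq]
  · obtain ⟨h1, h2, h3⟩ := hT
    obtain ⟨F, hF, hFc⟩ := h1.exists_isIntervalSum
    obtain ⟨G, hG, hGc⟩ := h2.exists_isIntervalSum
    exact ⟨F, G, hF, hG, hFc, hGc, h3⟩
  · rintro T F G ⟨hF, hG, hFc, hGc, hcompl⟩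
    refine ⟨⟨hF.mem_compatibleSets, hG.mem_compatibleSets, ?_, hF.valid', hG.valid',
      disjoint_intervalVec_of_support hcompl.disjoint (fun q hq => (hF.valid' q hq).2)
        (fun q hq i hi => hF.mem_support hq hi) fun q hq i hi => hG.mem_support hq hi⟩, ?_⟩
    -- Each part contributes as many intervals as its support has vertices, and the supports
    -- partition the vertex set.
    · rw [hFc, hGc, ← hcompl.compl_eq, Nat.card_coe_set_eq, Nat.card_coe_set_eq,
        Set.ncard_add_ncard_compl, Nat.card_eq_fintype_card, TypeA.card_eq]
    · rw [simplexTwo, fanSimplex_eq, hF.summandDims_eq, hG.summandDims_eq]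
      congr 2
      ext d
      refine exists_congr fun q => and_congr_right fun _ => ?_
      exact neg_eq_iff_eq_neg
  · rintro T T' F G ⟨h1, h2, -⟩ ⟨h1', h2', -⟩
    exact Prod.ext (isoClass_eq_iff.2 (h1.isIsomorphic h1'))
      (isoClass_eq_iff.2 (h2.isIsomorphic h2'))

end Count

end QuiverRep

theorem mainTheorem2 {k : Type u} [Field k] (n : ℕ) (o : Fin (n - 1) → Bool) :
    ((QuiverRep.tiltingClasses k (TypeA n o)).Finite ∧
      integralVolume (QuiverRep.polyTilt k (TypeA n o)) =
        ((QuiverRep.tiltingClasses k (TypeA n o)).ncard : ℝ≥0∞)) ∧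
    ((QuiverRep.supportTiltingClasses k (TypeA n o)).Finite ∧
      integralVolume (QuiverRep.polySupp k (TypeA n o)) =
        ((QuiverRep.supportTiltingClasses k (TypeA n o)).ncard : ℝ≥0∞)) ∧
    ((QuiverRep.twoSupportTiltingClasses k (TypeA n o)).Finite ∧
      integralVolume (QuiverRep.polyTwo k (TypeA n o)) =
        ((QuiverRep.twoSupportTiltingClasses k (TypeA n o)).ncard : ℝ≥0∞)) ∧
    (∀ T : QuiverRep k (TypeA n o), T.IsTilting →
      IsUnimodularSimplex T.simplexTilt ∧ integralVolume T.simplexTilt = 1) ∧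
    (∀ T : QuiverRep k (TypeA n o), T.IsSupportTilting →
      IsUnimodularSimplex T.simplexSupp ∧ integralVolume T.simplexSupp = 1) ∧
    (∀ T : QuiverRep k (TypeA n o) × QuiverRep k (TypeA n o),
      QuiverRep.IsTwoSupportTilting T →
        IsUnimodularSimplex (QuiverRep.simplexTwo T) ∧
          integralVolume (QuiverRep.simplexTwo T) = 1) ∧
    (∀ T T' : QuiverRep k (TypeA n o), T.IsTilting → T'.IsTilting →
      ¬ QuiverRep.IsIsomorphic T T' →
        volume (T.simplexTilt ∩ T'.simplexTilt) = 0) ∧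
    (∀ T T' : QuiverRep k (TypeA n o), T.IsSupportTilting → T'.IsSupportTilting →
      ¬ QuiverRep.IsIsomorphic T T' →
        volume (T.simplexSupp ∩ T'.simplexSupp) = 0) ∧
    (∀ T T' : QuiverRep k (TypeA n o) × QuiverRep k (TypeA n o),
      QuiverRep.IsTwoSupportTilting T → QuiverRep.IsTwoSupportTilting T' →
      ¬ (QuiverRep.IsIsomorphic T.1 T'.1 ∧ QuiverRep.IsIsomorphic T.2 T'.2) →
        volume (QuiverRep.simplexTwo T ∩ QuiverRep.simplexTwo T') = 0) := by
  have h1 := QuiverRep.tilting_count k n o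
  have h2 := QuiverRep.supportTilting_count k n o
  have h3 := QuiverRep.twoSupportTilting_count k n o
  refine ⟨h1.1, h2.1, h3.1, h1.2.1, h2.2.1, h3.2.1, fun T T' hT hT' hne => ?_,
    fun T T' hT hT' hne => ?_, fun T T' hT hT' hne => ?_⟩
  · exact h1.2.2 T T' hT hT' fun h => hne (QuiverRep.isoClass_eq_iff.1 h)
  · exact h2.2.2 T T' hT hT' fun h => hne (QuiverRep.isoClass_eq_iff.1 h)
  · refine h3.2.2 T T' hT hT' fun h => hne ?_
    obtain ⟨ha, hb⟩ := Prod.mk.inj h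
    exact ⟨QuiverRep.isoClass_eq_iff.1 ha, QuiverRep.isoClass_eq_iff.1 hb⟩
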